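/- Let $U$ be a random $4\times 4$ unitary matrix distributed according to the normalized Haar measure of $U(4)$ (the ensemble $\mathrm{CUE}_4$). Let $e^{i\varphi_1},\dots,e^{i\varphi_4}$ be its eigenvalues, with multiplicity, where $0\le\varphi_1\le\varphi_2\le\varphi_3\le\varphi_4<2\pi$, and let $$s_{\min}=\frac{4}{2\pi}\min\{\varphi_2-\varphi_1,\ \varphi_3-\varphi_2,\ \varphi_4-\varphi_3,\ 2\pi+\varphi_1-\varphi_4\}$$ be the minimal spacing between neighbouring eigenphases, normalized by the mean spacing $2\pi/4$. Define, for $s\in[0,1]$, $$\begin{aligned} P^U_4(s)=\frac{1}{72\pi^2}\sin^2\!\Big(\frac{\pi s}{4}\Big)\bigg(&666+720\pi^2(1-s)^2+36\big(11+16\pi^2(1-s)^2\big)\cos\frac{\pi s}{2}\\ &+18\big(8\pi^2(1-s)^2-13\big)\cos(\pi s)-100\cos\frac{3\pi s}{2}-608\cos(2\pi s)\\ &-380\cos\frac{5\pi s}{2}+234\cos(3\pi s)+74\cos\frac{7\pi s}{2}-58\cos(4\pi s)+10\cos\frac{9\pi s}{2}\\ &+24\pi(1-s)\Big[60\sin\frac{\pi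 s}{2}+63\sin(\pi s)+22\sin\frac{3\pi s}{2}+2\sin(2\pi s)-4\sin\frac{5\pi s}{2}\Big]\bigg). \end{aligned}$$ Then the random variable $s_{\min}$ takes values in $[0,1]$ almost surely and its law is absolutely continuous with density $P^U_4\ge 0$ on $[0,1]$ (and $0$ elsewhere). Moreover, the tail function $T(t)=\mathbb{P}(s_{\min}>t)$ is differentiable at every $t\in[0,1]$, with $-T'(t)=P^U_4(t)$. -/

import Mathlib

open MeasureTheory

namespace CUESpacing

/-! ### The circular unitary ensemble -/

noncomputable instance instMeasurableSpaceUnitaryGroup (N : ℕ) :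
    MeasurableSpace (Matrix.unitaryGroup (Fin N) ℂ) := borel _

instance instBorelSpaceUnitaryGroup (N : ℕ) :
    BorelSpace (Matrix.unitaryGroup (Fin N) ℂ) := ⟨rfl⟩

instance instCompactSpaceUnitaryGroup (N : ℕ) :
    CompactSpace (Matrix.unitaryGroup (Fin N) ℂ) := by
  have hsub : (Matrix.unitaryGroup (Fin N) ℂ : Set (Matrix (Fin N) (Fin N) ℂ)) ⊆
      Set.pi Set.univ fun _ => Set.pi Set.univ fun _ => Metric.closedBall (0 : ℂ) 1 := by
    intro U hU i _ j _
    simpa using entry_norm_bound_of_unitary hU i j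
  have hK : IsCompact (Set.pi Set.univ fun _ : Fin N => Set.pi Set.univ fun _ : Fin N =>
      Metric.closedBall (0 : ℂ) 1) :=
    isCompact_univ_pi fun _ => isCompact_univ_pi fun _ => isCompact_closedBall 0 1
  have hc : IsClosed (Matrix.unitaryGroup (Fin N) ℂ : Set (Matrix (Fin N) (Fin N) ℂ)) := by
    have : (Matrix.unitaryGroup (Fin N) ℂ : Set (Matrix (Fin N) (Fin N) ℂ)) =
        {U | U * star U = 1} := by
      ext U
      exact Matrix.mem_unitaryGroup_iff
    rw [this]
    exact isClosed_eq (continuous_id.mul continuous_star) continuous_const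
  exact isCompact_iff_compactSpace.mp (hK.of_isClosed_subset hc hsub)

/-- The circular unitary ensemble `CUE_N`: the Haar measure of the compact group `U(N)`,
normalized to total mass one. -/
noncomputable def cue (N : ℕ) : Measure (Matrix.unitaryGroup (Fin N) ℂ) :=
  Measure.haarMeasure ⊤

/-! ### Eigenphases and spacings -/

/-- The phase of `z`: for `|z| = 1`, the unique `φ ∈ [0, 2π)` with `z = exp (i φ)`. -/
noncomputable def phase (z : ℂ) : ℝ :=
  toIcoMod Real.two_pi_pos 0 z.arg

/-- The eigenphases of a matrix, listed in non-decreasing order and with algebraic multiplicity. -/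
noncomputable def eigenphaseList {N : ℕ} (A : Matrix (Fin N) (Fin N) ℂ) : List ℝ :=
  (A.charpoly.roots.map phase).sort (· ≤ ·)

theorem length_eigenphaseList {N : ℕ} (A : Matrix (Fin N) (Fin N) ℂ) :
    (eigenphaseList A).length = N := by
  simp [eigenphaseList, ← (IsAlgClosed.splits A.charpoly).natDegree_eq_card_roots]

/-- The eigenphases `φ_0 ≤ φ_1 ≤ … ≤ φ_{N-1}` in `[0, 2π)`. -/
noncomputable def eigenphase {N : ℕ} (A : Matrix (Fin N) (Fin N) ℂ) (j : Fin N) : ℝ :=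
  (eigenphaseList A).get (Fin.cast (length_eigenphaseList A).symm j)

/-- The spacing between the eigenphase number `j` and the next one on the circle:
`φ_{j+1} - φ_j` for `j + 1 < N`, and `2π + φ_0 - φ_{N-1}` for `j = N - 1`. -/
noncomputable def gap {N : ℕ} (A : Matrix (Fin N) (Fin N) ℂ) (j : Fin N) : ℝ :=
  if h : (j : ℕ) + 1 < N then eigenphase A ⟨j + 1, h⟩ - eigenphase A j
  else 2 * Real.pi + eigenphase A ⟨0, j.pos⟩ - eigenphase A j

/-- The minimal spacing `s_min`, in units of the mean spacing `2π / N`. -/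
noncomputable def sMin {N : ℕ} [NeZero N] (A : Matrix (Fin N) (Fin N) ℂ) : ℝ :=
  Finset.univ.inf' Finset.univ_nonempty fun j => gap A j / (2 * Real.pi / N)

/-! ### The explicit density -/

open Real in
/-- The explicit expression for the density of the minimal spacing of `CUE_4`. -/
noncomputable def densityCUE4 (s : ℝ) : ℝ :=
  1 / (72 * π ^ 2) * sin (π * s / 4) ^ 2 *
    (666 + 720 * π ^ 2 * (1 - s) ^ 2
      + 36 * (11 + 16 * π ^ 2 * (1 - s) ^ 2) * cos (π * s / 2)
      + 18 * (8 * π ^ 2 * (1 - s) ^ 2 - 13) * cos (π * s)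
      - 100 * cos (3 * π * s / 2) - 608 * cos (2 * π * s)
      - 380 * cos (5 * π * s / 2) + 234 * cos (3 * π * s)
      + 74 * cos (7 * π * s / 2) - 58 * cos (4 * π * s)
      + 10 * cos (9 * π * s / 2)
      + 24 * π * (1 - s) *
        (60 * sin (π * s / 2) + 63 * sin (π * s) + 22 * sin (3 * π * s / 2)
          + 2 * sin (2 * π * s) - 4 * sin (5 * π * s / 2)))

end CUESpacing

namespace CUESpacing

/-! ### Signed sums over integer intervals -/

section SignedSum

variable {M : Type*} [AddCommGroup M]

/-- The sum of `B 1, …, B k` for `k ≥ 0`, and minus the sum of `B (k + 1), …, B 0` for `k ≤ 0`. -/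
noncomputable def signedSum (k : ℤ) (B : ℤ → M) : M :=
  ∑ a ∈ Finset.Ioc 0 k, B a - ∑ a ∈ Finset.Ioc k 0, B a

@[simp]
theorem signedSum_zero (B : ℤ → M) : signedSum 0 B = 0 := by
  simp [signedSum]

theorem signedSum_add_one (k : ℤ) (B : ℤ → M) :
    signedSum (k + 1) B = signedSum k B + B (k + 1) := by
  unfold signedSum
  rcases le_or_gt 0 k with hk | hk
  · have h1 : Finset.Ioc 0 (k + 1) = insert (k + 1) (Finset.Ioc 0 k) := by
      ext a; simp only [Finset.mem_Ioc, Finset.mem_insert]; omega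
    have h2 : Finset.Ioc k 0 = ∅ := Finset.Ioc_eq_empty (by omega)
    have h3 : Finset.Ioc (k + 1) 0 = ∅ := Finset.Ioc_eq_empty (by omega)
    rw [h1, h2, h3, Finset.sum_insert (by simp)]
    simp only [Finset.sum_empty]; abel
  · have h1 : Finset.Ioc k 0 = insert (k + 1) (Finset.Ioc (k + 1) 0) := by
      ext a; simp only [Finset.mem_Ioc, Finset.mem_insert]; omega
    have h2 : Finset.Ioc 0 k = ∅ := Finset.Ioc_eq_empty (by omega)
    have h3 : Finset.Ioc 0 (k + 1) = ∅ := Finset.Ioc_eq_empty (by omega)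
    rw [h1, h2, h3, Finset.sum_insert (by simp)]
    simp only [Finset.sum_empty]; abel

theorem signedSum_sub_one (k : ℤ) (B : ℤ → M) :
    signedSum (k - 1) B = signedSum k B - B k := by
  have := signedSum_add_one (k - 1) B
  rw [sub_add_cancel] at this
  rw [this]; abel

theorem map_signedSum {M' F : Type*} [AddCommGroup M'] [FunLike F M M'] [AddMonoidHomClass F M M']
    (f : F) (k : ℤ) (B : ℤ → M) : f (signedSum k B) = signedSum k fun a => f (B a) := by
  simp [signedSum, map_sum]

theorem signedSum_sum {ι : Type*} (s : Finset ι) (k : ℤ) (B : ι → ℤ → M) :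
    signedSum k (fun a => ∑ i ∈ s, B i a) = ∑ i ∈ s, signedSum k (B i) := by
  simp only [signedSum, Finset.sum_sub_distrib]
  rw [Finset.sum_comm, Finset.sum_comm (s := Finset.Ioc k 0)]

theorem signedSum_const (k : ℤ) (b : M) : signedSum k (fun _ => b) = k • b := by
  induction k using Int.induction_on with
  | zero => simp
  | succ n ih => rw [signedSum_add_one, ih, add_smul, one_smul]
  | pred n ih => rw [signedSum_sub_one, ih, sub_smul, one_smul]

theorem signedSum_telescope (k : ℤ) (f : ℤ → M) :
    signedSum k (fun a => f (a + 1) - f a) = f (k + 1) - f 1 := by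
  induction k using Int.induction_on with
  | zero => simp
  | succ n ih => rw [signedSum_add_one, ih]; abel
  | pred n ih => rw [signedSum_sub_one, ih, sub_add_cancel]; abel

end SignedSum

/-! ### The polynomial algebra of power traces -/

/-- Polynomials in formal variables `X k`, standing for the power traces `tr (U ^ k)`, `k : ℤ`. -/
abbrev TracePoly := MvPolynomial ℤ ℂ

/-- The total derivative of a trace polynomial, as the family of its partial derivatives. -/
noncomputable def grad : Derivation ℂ TracePoly (ℤ →₀ TracePoly) :=
  MvPolynomial.mkDerivation ℂ fun k => Finsupp.single k 1

theorem grad_X (k : ℤ) : grad (MvPolynomial.X k : TracePoly) = Finsupp.single k 1 :=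
  MvPolynomial.mkDerivation_X ℂ _ k

theorem grad_X_mul (k : ℤ) (f : TracePoly) :
    grad (MvPolynomial.X k * f) = (MvPolynomial.X k : TracePoly) • grad f + Finsupp.single k f := by
  rw [Derivation.leibniz, grad_X, Finsupp.smul_single, smul_eq_mul, mul_one]

/-- The polynomial `X 1 * X (k - 1) + … + X k * X 0`, with the signed convention for `k < 0`. -/
noncomputable def loopSum (k : ℤ) : TracePoly :=
  signedSum k fun a => MvPolynomial.X a * MvPolynomial.X (k - a)

/-- The linear map sending a family `h` to `∑ l, l * X (k + l) * h l`. -/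
noncomputable def loopContract (k : ℤ) : (ℤ →₀ TracePoly) →ₗ[TracePoly] TracePoly :=
  Finsupp.lsum TracePoly fun l => LinearMap.lsmul TracePoly TracePoly
    ((l : TracePoly) * MvPolynomial.X (k + l))

theorem loopContract_single (k l : ℤ) (f : TracePoly) :
    loopContract k (Finsupp.single l f) = (l : TracePoly) * MvPolynomial.X (k + l) * f := by
  simp [loopContract]

/-- The Schwinger–Dyson operator: the divergence of `U ^ k * g` on the unitary group. -/
noncomputable def loopOp (k : ℤ) : TracePoly →ₗ[ℂ] TracePoly :=
  LinearMap.mulLeft ℂ (loopSum k) +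
    (loopContract k).restrictScalars ℂ ∘ₗ (grad : TracePoly →ₗ[ℂ] (ℤ →₀ TracePoly))

theorem loopOp_apply (k : ℤ) (g : TracePoly) :
    loopOp k g = loopSum k * g + loopContract k (grad g) := by
  simp [loopOp]

/-! ### Integration by parts on the unitary group -/

section Haar

variable {N : ℕ}

/-- The power traces of a unitary matrix. -/
noncomputable def powTrace (U : Matrix.unitaryGroup (Fin N) ℂ) (k : ℤ) : ℂ :=
  Matrix.trace ((U ^ k : Matrix.unitaryGroup (Fin N) ℂ) : Matrix (Fin N) (Fin N) ℂ)

/-- The derivative of `U ^ k` when `U` moves with velocity `U * X`. -/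
noncomputable def powDeriv (U : Matrix.unitaryGroup (Fin N) ℂ) (k : ℤ) :
    Matrix (Fin N) (Fin N) ℂ →ₗ[ℂ] Matrix (Fin N) (Fin N) ℂ :=
  signedSum k fun a => LinearMap.mulLeftRight ℂ ((U ^ a).1, (U ^ (k - a)).1)

theorem powDeriv_apply (U : Matrix.unitaryGroup (Fin N) ℂ) (k : ℤ)
    (X : Matrix (Fin N) (Fin N) ℂ) :
    powDeriv U k X = signedSum k fun a => (U ^ a).1 * X * (U ^ (k - a)).1 := by
  have := map_signedSum (LinearMap.applyₗ (R := ℂ) X) k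
    fun a => LinearMap.mulLeftRight ℂ ((U ^ a).1, (U ^ (k - a)).1)
  simpa [powDeriv] using this

theorem trace_powDeriv (U : Matrix.unitaryGroup (Fin N) ℂ) (k : ℤ)
    (X : Matrix (Fin N) (Fin N) ℂ) :
    (powDeriv U k X).trace = k * ((U ^ k).1 * X).trace := by
  have h : ∀ a, ((U ^ a).1 * X * (U ^ (k - a)).1).trace = ((U ^ k).1 * X).trace := by
    intro a
    rw [Matrix.trace_mul_comm, ← mul_assoc, ← Submonoid.coe_mul, ← zpow_add, sub_add_cancel]
  rw [powDeriv_apply, ← Matrix.traceAddMonoidHom_apply, map_signedSum]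
  simp only [Matrix.traceAddMonoidHom_apply, h, signedSum_const, zsmul_eq_mul]

/-- The derivative of a trace polynomial when `U` moves with velocity `U * X`. -/
noncomputable def traceDeriv (U : Matrix.unitaryGroup (Fin N) ℂ) (X : Matrix (Fin N) (Fin N) ℂ)
    (h : ℤ →₀ TracePoly) : ℂ :=
  h.sum fun l q => l * ((U ^ l).1 * X).trace * MvPolynomial.eval (powTrace U) q

section Curve

open scoped Matrix.Norms.Operator

theorem hasDerivAt_zpow_of_hasDerivAt {W : ℝ → Matrix.unitaryGroup (Fin N) ℂ}
    {X : Matrix (Fin N) (Fin N) ℂ} {t : ℝ}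
    (hW : HasDerivAt (fun s => (W s).1) ((W t).1 * X) t)
    (hW' : HasDerivAt (fun s => ((W s)⁻¹).1) (-(X * ((W t)⁻¹).1)) t) (k : ℤ) :
    HasDerivAt (fun s => (W s ^ k).1) (powDeriv (W t) k X) t := by
  simp only [powDeriv_apply]
  induction k using Int.induction_on with
  | zero =>
    simp only [zpow_zero, OneMemClass.coe_one, signedSum_zero]
    exact hasDerivAt_const t (1 : Matrix (Fin N) (Fin N) ℂ)
  | succ n ih =>
    have := ih.mul hW
    simp only [Pi.mul_def, ← Submonoid.coe_mul, ← zpow_add_one] at this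
    refine this.congr_deriv ?_
    rw [signedSum_add_one, sub_self, zpow_zero, OneMemClass.coe_one, mul_one, ← mul_assoc,
      ← Submonoid.coe_mul, ← zpow_add_one, ← AddMonoidHom.mulRight_apply, map_signedSum]
    simp only [AddMonoidHom.mulRight_apply, mul_assoc, ← Submonoid.coe_mul, ← zpow_add_one]
    simp only [sub_add_eq_add_sub]
  | pred n ih =>
    have := ih.mul hW'
    simp only [Pi.mul_def, ← Submonoid.coe_mul, ← zpow_sub_one] at this
    refine this.congr_deriv ?_
    rw [signedSum_sub_one, ← AddMonoidHom.mulRight_apply, map_signedSum]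
    simp only [AddMonoidHom.mulRight_apply, mul_assoc, ← Submonoid.coe_mul, ← zpow_sub_one]
    simp only [sub_right_comm, sub_self, zero_sub, zpow_neg_one, mul_neg, ← sub_eq_add_neg]

theorem hasDerivAt_linearMap_comp {E : Type*} [NormedAddCommGroup E] [NormedSpace ℂ E]
    [FiniteDimensional ℂ E] (L : E →ₗ[ℂ] ℂ) {f : ℝ → E} {f' : E} {t : ℝ}
    (hf : HasDerivAt f f' t) : HasDerivAt (fun s => L (f s)) (L f') t :=
  ((L.toContinuousLinearMap.restrictScalars ℝ).hasFDerivAt.comp_hasDerivAt t hf :)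

theorem hasDerivAt_eval_powTrace {W : ℝ → Matrix.unitaryGroup (Fin N) ℂ}
    {X : Matrix (Fin N) (Fin N) ℂ} {t : ℝ}
    (hW : HasDerivAt (fun s => (W s).1) ((W t).1 * X) t)
    (hW' : HasDerivAt (fun s => ((W s)⁻¹).1) (-(X * ((W t)⁻¹).1)) t) (g : TracePoly) :
    HasDerivAt (fun s => MvPolynomial.eval (powTrace (W s)) g) (traceDeriv (W t) X (grad g)) t := by
  have hadd : ∀ a b : ℤ →₀ TracePoly,
      traceDeriv (W t) X (a + b) = traceDeriv (W t) X a + traceDeriv (W t) X b := fun a b =>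
    Finsupp.sum_add_index' (by simp) (by simp [mul_add])
  have hsmul : ∀ (p : TracePoly) (a : ℤ →₀ TracePoly),
      traceDeriv (W t) X (p • a) = MvPolynomial.eval (powTrace (W t)) p * traceDeriv (W t) X a := by
    intro p a
    unfold traceDeriv
    rw [Finsupp.sum_smul_index' (by simp), Finsupp.mul_sum]
    refine Finsupp.sum_congr fun l _ => ?_
    simp only [smul_eq_mul, map_mul]; ring
  induction g using MvPolynomial.induction_on with
  | C a => simpa [traceDeriv] using hasDerivAt_const t a
  | add p q hp hq =>
    simp only [map_add, hadd]
    exact hp.add hq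
  | mul_X p k hp =>
    have h1 : HasDerivAt (fun s => powTrace (W s) k) (k * ((W t ^ k).1 * X).trace) t := by
      have := hasDerivAt_linearMap_comp (Matrix.traceLinearMap (Fin N) ℂ ℂ)
        (hasDerivAt_zpow_of_hasDerivAt hW hW' k)
      simp only [Matrix.traceLinearMap_apply, trace_powDeriv] at this
      exact this
    have := hp.mul h1
    simp only [map_mul, MvPolynomial.eval_X]
    refine this.congr_deriv ?_
    rw [mul_comm p, grad_X_mul, hadd, hsmul, MvPolynomial.eval_X]
    simp only [traceDeriv, Finsupp.sum_single_index, map_zero, mul_zero]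
    ring

/-- The one-parameter subgroup generated by a skew-Hermitian matrix. -/
noncomputable def expCurve (X : Matrix (Fin N) (Fin N) ℂ) (hX : star X = -X) (t : ℝ) :
    Matrix.unitaryGroup (Fin N) ℂ :=
  ⟨NormedSpace.exp (t • X), by
    rw [Matrix.mem_unitaryGroup_iff, Matrix.star_eq_conjTranspose, ← Matrix.exp_conjTranspose,
      Matrix.conjTranspose_smul, ← Matrix.star_eq_conjTranspose X, hX]
    have h := Matrix.exp_add_of_commute (t • X) (-(t • X)) (Commute.refl (t • X)).neg_right
    rw [star_trivial, smul_neg, ← h, add_neg_cancel, NormedSpace.exp_zero]⟩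

theorem coe_inv_expCurve (X : Matrix (Fin N) (Fin N) ℂ) (hX : star X = -X) (t : ℝ) :
    ((expCurve X hX t)⁻¹).1 = NormedSpace.exp (t • (-X)) := by
  have : ((expCurve X hX t)⁻¹).1 = star (NormedSpace.exp (t • X)) := rfl
  rw [this, Matrix.star_eq_conjTranspose, ← Matrix.exp_conjTranspose,
    Matrix.conjTranspose_smul, ← Matrix.star_eq_conjTranspose X, hX, star_trivial]

theorem hasDerivAt_mul_expCurve (U : Matrix.unitaryGroup (Fin N) ℂ)
    (X : Matrix (Fin N) (Fin N) ℂ) (hX : star X = -X) (t : ℝ) :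
    HasDerivAt (fun s => (U * expCurve X hX s).1) ((U * expCurve X hX t).1 * X) t := by
  have := (hasDerivAt_exp_smul_const (𝕂 := ℝ) X t).const_mul U.1
  simp only [← mul_assoc] at this
  exact this

theorem hasDerivAt_inv_mul_expCurve (U : Matrix.unitaryGroup (Fin N) ℂ)
    (X : Matrix (Fin N) (Fin N) ℂ) (hX : star X = -X) (t : ℝ) :
    HasDerivAt (fun s => ((U * expCurve X hX s)⁻¹).1)
      (-(X * ((U * expCurve X hX t)⁻¹).1)) t := by
  have := (hasDerivAt_exp_smul_const' (𝕂 := ℝ) (-X) t).mul_const ((U⁻¹).1)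
  simp only [mul_assoc, neg_mul] at this
  simp only [mul_inv_rev, Submonoid.coe_mul, coe_inv_expCurve]
  exact this

instance isProbabilityMeasure_cue : IsProbabilityMeasure (cue N) :=
  ⟨Measure.haarMeasure_self
    (K₀ := (⊤ : TopologicalSpace.PositiveCompacts (Matrix.unitaryGroup (Fin N) ℂ)))⟩

instance isHaarMeasure_cue : (cue N).IsHaarMeasure := by
  unfold cue; infer_instance

instance isMulRightInvariant_cue : (cue N).IsMulRightInvariant := by
  refine ⟨fun g => ?_⟩
  have : IsProbabilityMeasure (Measure.map (· * g) (cue N)) :=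
    Measure.isProbabilityMeasure_map (measurable_mul_const g).aemeasurable
  exact Measure.isHaarMeasure_eq_of_isProbabilityMeasure _ _

theorem continuous_coe_zpow (k : ℤ) :
    Continuous fun U : Matrix.unitaryGroup (Fin N) ℂ => (U ^ k).1 :=
  continuous_subtype_val.comp (continuous_zpow k)

theorem continuous_eval_powTrace (g : TracePoly) :
    Continuous fun U : Matrix.unitaryGroup (Fin N) ℂ => MvPolynomial.eval (powTrace U) g :=
  (MvPolynomial.continuous_eval g).comp
    (continuous_pi fun k => (continuous_coe_zpow k).matrix_trace)

theorem integrable_cue_of_continuous {f : Matrix.unitaryGroup (Fin N) ℂ → ℂ} (hf : Continuous f) :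
    Integrable f (cue N) :=
  hf.integrable_of_hasCompactSupport (HasCompactSupport.of_compactSpace f)

/-- The derivative of the function `(U ^ k) i j * g U` when `U` moves with velocity `U * X`. -/
noncomputable def entryDeriv (k : ℤ) (g : TracePoly) (i j : Fin N)
    (X : Matrix (Fin N) (Fin N) ℂ) (U : Matrix.unitaryGroup (Fin N) ℂ) : ℂ :=
  powDeriv U k X i j * MvPolynomial.eval (powTrace U) g + (U ^ k).1 i j * traceDeriv U X (grad g)

theorem continuous_entryDeriv (k : ℤ) (g : TracePoly) (i j : Fin N)
    (X : Matrix (Fin N) (Fin N) ℂ) : Continuous (entryDeriv k g i j X) := by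
  have h1 : Continuous fun U : Matrix.unitaryGroup (Fin N) ℂ => powDeriv U k X := by
    simp only [powDeriv_apply, signedSum]
    refine Continuous.sub ?_ ?_ <;> refine continuous_finsetSum _ fun a _ => ?_ <;>
      exact ((continuous_coe_zpow a).matrix_mul continuous_const).matrix_mul
        (continuous_coe_zpow (k - a))
  have h2 : Continuous fun U : Matrix.unitaryGroup (Fin N) ℂ => traceDeriv U X (grad g) := by
    refine continuous_finsetSum _ fun l _ => ?_
    exact (continuous_const.mul ((continuous_coe_zpow l).matrix_mul
      continuous_const).matrix_trace).mul (continuous_eval_powTrace _)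
  exact ((h1.matrix_elem i j).mul (continuous_eval_powTrace g)).add
    (((continuous_coe_zpow k).matrix_elem i j).mul h2)

theorem integral_entryDeriv_of_star_eq_neg (k : ℤ) (g : TracePoly) (i j : Fin N)
    (X : Matrix (Fin N) (Fin N) ℂ) (hX : star X = -X) :
    ∫ U, entryDeriv k g i j X U ∂(cue N) = 0 := by
  obtain ⟨C, hC⟩ := (isCompact_range (continuous_entryDeriv k g i j X)).isBounded.exists_norm_le
  have hφ : Continuous fun U : Matrix.unitaryGroup (Fin N) ℂ =>
      (U ^ k).1 i j * MvPolynomial.eval (powTrace U) g :=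
    ((continuous_coe_zpow k).matrix_elem i j).mul (continuous_eval_powTrace g)
  set φ : Matrix.unitaryGroup (Fin N) ℂ → ℂ := fun U =>
      (U ^ k).1 i j * MvPolynomial.eval (powTrace U) g with hφdef
  have hder : ∀ U t, HasDerivAt (fun s => φ (U * expCurve X hX s))
      (entryDeriv k g i j X (U * expCurve X hX t)) t := by
    intro U t
    have h1 := hasDerivAt_mul_expCurve U X hX t
    have h2 := hasDerivAt_inv_mul_expCurve U X hX t
    have h3 := hasDerivAt_linearMap_comp (Matrix.entryLinearMap ℂ ℂ i j)
      (hasDerivAt_zpow_of_hasDerivAt h1 h2 k)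
    exact h3.mul (hasDerivAt_eval_powTrace h1 h2 g)
  have key := (hasDerivAt_integral_of_dominated_loc_of_deriv_le (μ := cue N) (x₀ := (0 : ℝ))
    (s := Set.univ) (bound := fun _ => C) (F := fun t U => φ (U * expCurve X hX t))
    (F' := fun t U => entryDeriv k g i j X (U * expCurve X hX t)) Filter.univ_mem
    (Filter.Eventually.of_forall fun t =>
      (hφ.comp (continuous_mul_const _)).aestronglyMeasurable)
    (integrable_cue_of_continuous (hφ.comp (continuous_mul_const _)))
    ((continuous_entryDeriv k g i j X).comp (continuous_mul_const _)).aestronglyMeasurable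
    (ae_of_all _ fun U t _ => hC _ (Set.mem_range_self _))
    (integrable_const C) (ae_of_all _ fun U t _ => hder U t)).2
  simp only [integral_mul_right_eq_self] at key
  exact key.unique (hasDerivAt_const _ _)

end Curve

theorem entryDeriv_add (k : ℤ) (g : TracePoly) (i j : Fin N) (X Y : Matrix (Fin N) (Fin N) ℂ)
    (U : Matrix.unitaryGroup (Fin N) ℂ) :
    entryDeriv k g i j (X + Y) U = entryDeriv k g i j X U + entryDeriv k g i j Y U := by
  simp only [entryDeriv, traceDeriv, map_add, Matrix.add_apply, mul_add, Matrix.trace_add, add_mul,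
    Finsupp.sum_add]
  ring

theorem entryDeriv_smul (k : ℤ) (g : TracePoly) (i j : Fin N) (c : ℂ)
    (X : Matrix (Fin N) (Fin N) ℂ) (U : Matrix.unitaryGroup (Fin N) ℂ) :
    entryDeriv k g i j (c • X) U = c * entryDeriv k g i j X U := by
  have h : traceDeriv U (c • X) (grad g) = c * traceDeriv U X (grad g) := by
    simp only [traceDeriv, Finsupp.mul_sum]
    refine Finsupp.sum_congr fun l _ => ?_
    rw [mul_smul_comm, Matrix.trace_smul, smul_eq_mul]; ring
  simp only [entryDeriv, h, map_smul, Matrix.smul_apply, smul_eq_mul]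
  ring

theorem integral_entryDeriv (k : ℤ) (g : TracePoly) (i j : Fin N)
    (X : Matrix (Fin N) (Fin N) ℂ) : ∫ U, entryDeriv k g i j X U ∂(cue N) = 0 := by
  have hdec : X = (2⁻¹ : ℂ) • (X - star X) +
      (-(2⁻¹ * Complex.I)) • (Complex.I • (X + star X)) := by
    rw [smul_smul, neg_mul, mul_assoc, Complex.I_mul_I, smul_sub, smul_add]
    module
  have h1 : star (X - star X) = -(X - star X) := by rw [star_sub, star_star]; abel
  have h2 : star (Complex.I • (X + star X)) = -(Complex.I • (X + star X)) := by
    rw [star_smul, star_add, star_star, add_comm (star X), ← neg_smul]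
    simp only [Complex.star_def, Complex.conj_I]
  rw [hdec]
  simp only [entryDeriv_add _ _ _ _ ((2⁻¹ : ℂ) • (X - star X)), entryDeriv_smul _ _ _ _ 2⁻¹,
    entryDeriv_smul _ _ _ _ (-(2⁻¹ * Complex.I))]
  rw [integral_add, integral_const_mul, integral_const_mul,
    integral_entryDeriv_of_star_eq_neg _ _ _ _ _ h1,
    integral_entryDeriv_of_star_eq_neg _ _ _ _ _ h2, mul_zero, mul_zero, add_zero]
  · exact (integrable_cue_of_continuous (continuous_entryDeriv _ _ _ _ _)).const_mul _
  · exact (integrable_cue_of_continuous (continuous_entryDeriv _ _ _ _ _)).const_mul _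

theorem sum_entryDeriv (k : ℤ) (g : TracePoly) (U : Matrix.unitaryGroup (Fin N) ℂ) :
    ∑ i, ∑ j, entryDeriv k g i j (Matrix.single i j 1) U =
      MvPolynomial.eval (powTrace U) (loopOp k g) := by
  have h1 : ∑ i, ∑ j, powDeriv U k (Matrix.single i j 1) i j =
      MvPolynomial.eval (powTrace U) (loopSum k) := by
    have h : ∀ i j, powDeriv U k (Matrix.single i j 1) i j =
        signedSum k fun a => (U ^ a).1 i i * (U ^ (k - a)).1 j j := by
      intro i j
      have := map_signedSum (Matrix.entryLinearMap ℂ ℂ i j) k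
        fun a => (U ^ a).1 * Matrix.single i j 1 * (U ^ (k - a)).1
      rw [powDeriv_apply]
      refine this.trans (congrArg _ (funext fun a => ?_))
      simp only [Matrix.entryLinearMap_apply, Matrix.mul_apply, Matrix.single_apply, ite_and,
        mul_ite, mul_one, mul_zero, Finset.sum_ite_eq, Finset.mem_univ, if_true, ite_mul, zero_mul]
    simp only [h, loopSum, ← signedSum_sum, map_signedSum, map_mul, MvPolynomial.eval_X, powTrace,
      Matrix.trace, Matrix.diag, Finset.sum_mul_sum]
  have h2 : ∑ i, ∑ j, (U ^ k).1 i j * traceDeriv U (Matrix.single i j 1) (grad g) =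
      MvPolynomial.eval (powTrace U) (loopContract k (grad g)) := by
    simp only [traceDeriv, loopContract, Finsupp.lsum_apply, Finsupp.sum, map_sum, Finset.mul_sum]
    rw [Finset.sum_congr rfl fun i _ => Finset.sum_comm, Finset.sum_comm]
    refine Finset.sum_congr rfl fun l _ => ?_
    have h3 : powTrace U (k + l) = ∑ i, ∑ j, (U ^ k).1 i j * (U ^ l).1 j i := by
      rw [powTrace, zpow_add, Submonoid.coe_mul]
      simp [Matrix.trace, Matrix.mul_apply]
    simp only [LinearMap.lsmul_apply, smul_eq_mul, map_mul, MvPolynomial.eval_X, map_intCast, h3,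
      Matrix.trace_mul_single, Finset.mul_sum, Finset.sum_mul]
    refine Finset.sum_congr rfl fun i _ => Finset.sum_congr rfl fun j _ => ?_
    simp; ring
  rw [loopOp_apply, map_add, map_mul, ← h1, ← h2]
  simp only [entryDeriv, Finset.sum_add_distrib, Finset.sum_mul]

/-- The loop equations for the circular unitary ensemble. -/
theorem integral_loopOp (k : ℤ) (g : TracePoly) :
    ∫ U, MvPolynomial.eval (powTrace U) (loopOp k g) ∂(cue N) = 0 := by
  have hInt : ∀ i j : Fin N, Integrable (entryDeriv k g i j (Matrix.single i j 1)) (cue N) :=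
    fun i j => integrable_cue_of_continuous (continuous_entryDeriv _ _ _ _ _)
  simp only [← sum_entryDeriv]
  rw [integral_finsetSum _ fun i _ => integrable_finsetSum _ fun j _ => hInt i j]
  refine Finset.sum_eq_zero fun i _ => ?_
  rw [integral_finsetSum _ fun j _ => hInt i j]
  exact Finset.sum_eq_zero fun j _ => integral_entryDeriv _ _ _ _ _

end Haar

/-! ### The Laplacian on trace polynomials -/

/-- The Laplacian of the unitary group, acting on trace polynomials. -/
noncomputable def laplacian : TracePoly →ₗ[ℂ] TracePoly :=
  (Finsupp.lsum ℂ fun k : ℤ => (k : ℂ) • loopOp k) ∘ₗ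
    (grad : TracePoly →ₗ[ℂ] (ℤ →₀ TracePoly))

theorem integral_laplacian {N : ℕ} (f : TracePoly) :
    ∫ U, MvPolynomial.eval (powTrace U) (laplacian f) ∂(cue N) = 0 := by
  simp only [laplacian, LinearMap.comp_apply, Finsupp.lsum_apply, Finsupp.sum, map_sum,
    LinearMap.smul_apply, MvPolynomial.smul_eval]
  rw [integral_finsetSum _ fun k _ =>
    (integrable_cue_of_continuous (continuous_eval_powTrace _)).const_mul _]
  refine Finset.sum_eq_zero fun k _ => ?_
  rw [integral_const_mul, integral_loopOp, mul_zero]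

theorem laplacian_C (a : ℂ) : laplacian (MvPolynomial.C a) = 0 := by
  simp [laplacian]

theorem laplacian_X_mul (k : ℤ) (f : TracePoly) :
    laplacian (MvPolynomial.X k * f) = MvPolynomial.X k * laplacian f +
      (k : TracePoly) * loopSum k * f + 2 * (k : TracePoly) * loopContract k (grad f) := by
  have key : ∀ h : ℤ →₀ TracePoly,
      (Finsupp.lsum ℂ fun k : ℤ => (k : ℂ) • loopOp k) ((MvPolynomial.X k : TracePoly) • h) =
      MvPolynomial.X k * (Finsupp.lsum ℂ fun k : ℤ => (k : ℂ) • loopOp k) h +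
        (k : TracePoly) * loopContract k h := by
    intro h
    induction h using Finsupp.induction_linear with
    | zero => simp
    | add a b ha hb => rw [smul_add, map_add, ha, hb, map_add, map_add]; ring
    | single l q =>
      rw [Finsupp.smul_single, Finsupp.lsum_single, Finsupp.lsum_single, loopContract_single,
        LinearMap.smul_apply, LinearMap.smul_apply, loopOp_apply, loopOp_apply, smul_eq_mul,
        grad_X_mul, map_add, map_smul, loopContract_single, add_comm k l]
      simp only [MvPolynomial.smul_eq_C_mul, smul_eq_mul, map_intCast]
      ring
  have h : ∀ g, laplacian g =
      (Finsupp.lsum ℂ fun k : ℤ => (k : ℂ) • loopOp k) (grad g) := fun g => rfl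
  rw [h, h, grad_X_mul, map_add, key, Finsupp.lsum_single, LinearMap.smul_apply, loopOp_apply]
  simp only [MvPolynomial.smul_eq_C_mul, map_intCast]
  ring

/-! ### Laurent polynomials in four variables -/

/-- Laurent polynomials in four variables. -/
abbrev Laurent := AddMonoidAlgebra ℂ (Fin 4 → ℤ)

namespace Laurent

theorem induction_linear {p : Laurent → Prop} (x : Laurent) (zero : p 0)
    (add : ∀ x y, p x → p y → p (x + y)) (single : ∀ m a, p (AddMonoidAlgebra.single m a)) : p x := by
  rw [← AddMonoidAlgebra.sum_coeff_single x, Finsupp.sum]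
  exact Finset.sum_induction _ p add zero fun m _ => single _ _

/-- The operator multiplying the coefficient of the monomial `m` by `h m`. -/
noncomputable def diagOp (h : (Fin 4 → ℤ) → ℂ) : Laurent →ₗ[ℂ] Laurent :=
  (Finsupp.lsum ℂ fun m => h m • AddMonoidAlgebra.lsingle m) ∘ₗ
    (AddMonoidAlgebra.coeffLinearEquiv ℂ).toLinearMap

theorem diagOp_single (h : (Fin 4 → ℤ) → ℂ) (m : Fin 4 → ℤ) (a : ℂ) :
    diagOp h (AddMonoidAlgebra.single m a) = AddMonoidAlgebra.single m (h m * a) := by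
  have : AddMonoidAlgebra.coeffLinearEquiv ℂ (AddMonoidAlgebra.single m a) = Finsupp.single m a :=
    rfl
  rw [diagOp, LinearMap.comp_apply, LinearEquiv.coe_coe, this, Finsupp.lsum_single,
    LinearMap.smul_apply]
  exact AddMonoidAlgebra.smul_single _ _ _

theorem coeff_diagOp (h : (Fin 4 → ℤ) → ℂ) (x : Laurent) (m : Fin 4 → ℤ) :
    (diagOp h x).coeff m = h m * x.coeff m := by
  classical
  induction x using induction_linear with
  | zero => simp
  | add x y hx hy => simp [hx, hy, mul_add]
  | single n a =>
    rw [diagOp_single, AddMonoidAlgebra.coeff_single, AddMonoidAlgebra.coeff_single,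
      Finsupp.single_apply, Finsupp.single_apply]
    split_ifs with hn
    · rw [hn]
    · simp

/-- The Euler derivation `u_i ∂/∂u_i`. -/
noncomputable def euler (i : Fin 4) : Derivation ℂ Laurent Laurent :=
  Derivation.mk' (diagOp fun m => (m i : ℂ)) <| by
    intro x y
    induction x using induction_linear with
    | zero => simp
    | add a b ha hb => simp only [add_mul, map_add, ha, hb, smul_eq_mul]; ring
    | single m a =>
      induction y using induction_linear with
      | zero => simp
      | add c d hc hd => simp only [mul_add, map_add, hc, hd, smul_eq_mul]; ring
      | single n b =>
        simp only [AddMonoidAlgebra.single_mul_single, diagOp_single, smul_eq_mul, Pi.add_apply,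
          add_comm n m, ← AddMonoidAlgebra.single_add]
        push_cast
        ring_nf

theorem euler_apply (i : Fin 4) (x : Laurent) : euler i x = diagOp (fun m => (m i : ℂ)) x := rfl

/-- The monomial `u_i ^ k`. -/
noncomputable def mono (i : Fin 4) (k : ℤ) : Laurent := AddMonoidAlgebra.single (Pi.single i k) 1

theorem mono_add (i : Fin 4) (k l : ℤ) : mono i (k + l) = mono i k * mono i l := by
  simp [mono, AddMonoidAlgebra.single_mul_single, Pi.single_add]

theorem mono_zero (i : Fin 4) : mono i 0 = 1 := by
  simp [mono, AddMonoidAlgebra.one_def]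

theorem euler_mono_self (i : Fin 4) (k : ℤ) : euler i (mono i k) = (k : Laurent) * mono i k := by
  rw [euler_apply, mono, diagOp_single, Pi.single_eq_same, ← AddMonoidAlgebra.smul_single',
    Int.cast_smul_eq_zsmul, zsmul_eq_mul]

theorem euler_mono_of_ne {i j : Fin 4} (h : i ≠ j) (k : ℤ) : euler i (mono j k) = 0 := by
  rw [euler_apply, mono, diagOp_single, Pi.single_eq_of_ne h]
  simp

/-- The power sum `u_0 ^ k + … + u_3 ^ k`. -/
noncomputable def powSum (k : ℤ) : Laurent := ∑ i, mono i k

theorem euler_powSum (i : Fin 4) (k : ℤ) : euler i (powSum k) = (k : Laurent) * mono i k := by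
  rw [powSum, map_sum, Finset.sum_eq_single i (fun j _ h => euler_mono_of_ne h.symm k) (by simp),
    euler_mono_self]

/-- The Vandermonde determinant. -/
noncomputable def vander : Laurent :=
  ∑ σ : Equiv.Perm (Fin 4), AddMonoidAlgebra.single (fun i => ((σ i : ℕ) : ℤ))
    ((Equiv.Perm.sign σ : ℤ) : ℂ)

theorem mono_natCast (i : Fin 4) (n : ℕ) : mono i n = mono i 1 ^ n := by
  induction n with
  | zero => simpa using mono_zero i
  | succ n ih => rw [Nat.cast_succ, mono_add, ih, pow_succ]

theorem prod_mono (m : Fin 4 → ℤ) : ∏ i, mono i (m i) = AddMonoidAlgebra.single m 1 := by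
  have h : m = Pi.single 0 (m 0) + Pi.single 1 (m 1) + Pi.single 2 (m 2) + Pi.single 3 (m 3) := by
    ext i; fin_cases i <;> simp
  rw [Fin.prod_univ_four]
  conv_rhs => rw [h]
  simp only [mono, AddMonoidAlgebra.single_mul_single, one_mul]

theorem vander_eq_det : vander = Matrix.det (Matrix.vandermonde fun i => mono i 1) := by
  rw [← Matrix.det_transpose, Matrix.det_apply', vander]
  refine Finset.sum_congr rfl fun σ _ => ?_
  simp only [Matrix.transpose_apply, Matrix.vandermonde_apply, ← mono_natCast]
  rw [prod_mono, ← mul_one (((Equiv.Perm.sign σ : ℤ) : ℂ)), ← AddMonoidAlgebra.smul_single',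
    Int.cast_smul_eq_zsmul, zsmul_eq_mul]

theorem vander_eq_prod : vander =
    (mono 1 1 - mono 0 1) * (mono 2 1 - mono 0 1) * (mono 3 1 - mono 0 1) *
    (mono 2 1 - mono 1 1) * (mono 3 1 - mono 1 1) * (mono 3 1 - mono 2 1) := by
  have h0 : Finset.Ioi (0 : Fin 4) = {1, 2, 3} := by decide
  have h1 : Finset.Ioi (1 : Fin 4) = {2, 3} := by decide
  have h2 : Finset.Ioi (2 : Fin 4) = {3} := by decide
  have h3 : Finset.Ioi (3 : Fin 4) = ∅ := by decide
  rw [vander_eq_det, Matrix.det_vandermonde, Fin.prod_univ_four, h0, h1, h2, h3]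
  simp only [Finset.prod_empty, Finset.prod_singleton, mul_one]
  rw [Finset.prod_insert (by decide), Finset.prod_insert (by decide), Finset.prod_singleton,
    Finset.prod_insert (by decide), Finset.prod_singleton]
  ring

/-- The eigenvalue of the radial Laplacian on the monomial `m`, after conjugation by the
Vandermonde determinant. -/
def casimir (m : Fin 4 → ℤ) : ℤ := ∑ i, (m i ^ 2 - 3 * m i) + 4

theorem casimir_perm (σ : Equiv.Perm (Fin 4)) : casimir (fun i => ((σ i : ℕ) : ℤ)) = 0 := by
  unfold casimir
  rw [Equiv.sum_comp σ fun i : Fin 4 => (((i : ℕ) : ℤ) ^ 2 - 3 * ((i : ℕ) : ℤ))]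
  decide

/-- The flat Laplacian, shifted. -/
noncomputable def flatLap : Laurent →ₗ[ℂ] Laurent := diagOp fun m => (casimir m : ℂ)

theorem flatLap_vander : flatLap vander = 0 := by
  rw [vander, map_sum]
  refine Finset.sum_eq_zero fun σ _ => ?_
  rw [flatLap, diagOp_single, casimir_perm]
  simp

theorem flatLap_eq (x : Laurent) :
    flatLap x = ∑ i, (euler i (euler i x) - 3 * euler i x) + 4 * x := by
  induction x using induction_linear with
  | zero => simp
  | add x y hx hy =>
    simp only [map_add, hx, hy, mul_add, Finset.sum_add_distrib, Finset.sum_sub_distrib]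
    ring
  | single m a =>
    have h3 : ∀ b : ℂ, (3 : Laurent) * AddMonoidAlgebra.single m b =
        AddMonoidAlgebra.single m (3 * b) := by
      intro b; rw [AddMonoidAlgebra.ofNat_def, AddMonoidAlgebra.single_mul_single, zero_add]
    have h4 : ∀ b : ℂ, (4 : Laurent) * AddMonoidAlgebra.single m b =
        AddMonoidAlgebra.single m (4 * b) := by
      intro b; rw [AddMonoidAlgebra.ofNat_def, AddMonoidAlgebra.single_mul_single, zero_add]
    simp only [flatLap, euler_apply, diagOp_single, h3, h4, Fin.sum_univ_four, casimir,
      ← AddMonoidAlgebra.single_add, ← AddMonoidAlgebra.single_sub]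
    congr 1
    push_cast
    ring

theorem flatLap_powSum_mul (k : ℤ) (x : Laurent) :
    flatLap (powSum k * x) = powSum k * flatLap x + ((k : Laurent) ^ 2 - 3 * k) * powSum k * x +
      2 * k * ∑ i, mono i k * euler i x := by
  have h : ∀ i, euler i (euler i (powSum k * x)) - 3 * euler i (powSum k * x) =
      powSum k * (euler i (euler i x) - 3 * euler i x) +
      ((k : Laurent) ^ 2 - 3 * k) * mono i k * x + 2 * k * (mono i k * euler i x) := by
    intro i
    simp only [Derivation.leibniz, map_add, smul_eq_mul, euler_powSum, euler_mono_self,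
      Derivation.map_intCast]
    ring
  rw [flatLap_eq, flatLap_eq, Finset.sum_congr rfl fun i _ => h i, Finset.sum_add_distrib,
    Finset.sum_add_distrib, ← Finset.mul_sum, ← Finset.mul_sum]
  rw [show ∑ i, ((k : Laurent) ^ 2 - 3 * k) * mono i k * x =
    ((k : Laurent) ^ 2 - 3 * k) * powSum k * x by rw [powSum, Finset.mul_sum, Finset.sum_mul]]
  ring

end Laurent

open Laurent

/-- The Laurent polynomial obtained by substituting the power sums for the variables. -/
noncomputable def toLaurent : TracePoly →ₐ[ℂ] Laurent := MvPolynomial.aeval powSum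

theorem toLaurent_X (k : ℤ) : toLaurent (MvPolynomial.X k) = powSum k :=
  MvPolynomial.aeval_X _ _

theorem sum_mono_mul_euler_toLaurent (k : ℤ) (f : TracePoly) :
    ∑ i, mono i k * euler i (toLaurent f) = toLaurent (loopContract k (grad f)) := by
  induction f using MvPolynomial.induction_on with
  | C a =>
    rw [toLaurent, MvPolynomial.aeval_C]
    simp only [Derivation.map_algebraMap, mul_zero, Finset.sum_const_zero]
    simp
  | add p q hp hq => simp only [map_add, mul_add, Finset.sum_add_distrib, hp, hq]
  | mul_X p l hp =>
    rw [mul_comm p, grad_X_mul, map_add, map_smul, loopContract_single, map_mul, smul_eq_mul,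
      map_add, map_mul, ← hp, toLaurent_X, map_mul, map_mul, map_intCast, toLaurent_X,
      show powSum (k + l) = ∑ i, mono i (k + l) from rfl,
      Finset.mul_sum, Finset.mul_sum, Finset.sum_mul, ← Finset.sum_add_distrib]
    refine Finset.sum_congr rfl fun i _ => ?_
    rw [Derivation.leibniz, euler_powSum, mono_add]
    simp only [smul_eq_mul]
    ring

theorem sub_mul_signedSum_mono (i j : Fin 4) (k : ℤ) :
    (mono i 1 - mono j 1) * signedSum k (fun a => mono i a * mono j (k - a)) =
      mono i 1 * mono i k - mono i 1 * mono j k := by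
  have h := signedSum_telescope k fun a => mono i a * mono j (k - a + 1)
  rw [← AddMonoidHom.coe_mulLeft, map_signedSum]
  simp only [AddMonoidHom.coe_mulLeft]
  calc _ = signedSum k (fun a => mono i (a + 1) * mono j (k - (a + 1) + 1) -
        mono i a * mono j (k - a + 1)) := by
        congr 1; ext1 a
        rw [show k - (a + 1) + 1 = k - a by ring, mono_add, mono_add]; ring
    _ = _ := by
        rw [h, show k - (k + 1) + 1 = 0 by ring, show k - 1 + 1 = k by ring, mono_zero, mono_add]
        ring

theorem toLaurent_loopSum (k : ℤ) : toLaurent (loopSum k) =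
    ∑ i, ∑ j, signedSum k (fun a => mono i a * mono j (k - a)) := by
  simp only [loopSum, map_signedSum, map_mul, toLaurent_X, powSum, Finset.sum_mul_sum,
    ← signedSum_sum]

theorem signedSum_mono_self (i : Fin 4) (k : ℤ) :
    signedSum k (fun a => mono i a * mono i (k - a)) = (k : Laurent) * mono i k := by
  simp only [← mono_add, add_sub_cancel, signedSum_const, zsmul_eq_mul]

theorem two_mul_sum_mono_mul_euler_vander (k : ℤ) :
    2 * ∑ i, mono i k * euler i vander =
      vander * (toLaurent (loopSum k) + 3 * powSum k - (k : Laurent) * powSum k) := by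
  rw [toLaurent_loopSum]
  simp only [Fin.sum_univ_four, powSum, signedSum_mono_self]
  have h01 := sub_mul_signedSum_mono 0 1 k
  have h02 := sub_mul_signedSum_mono 0 2 k
  have h03 := sub_mul_signedSum_mono 0 3 k
  have h12 := sub_mul_signedSum_mono 1 2 k
  have h13 := sub_mul_signedSum_mono 1 3 k
  have h23 := sub_mul_signedSum_mono 2 3 k
  have h10 := sub_mul_signedSum_mono 1 0 k
  have h20 := sub_mul_signedSum_mono 2 0 k
  have h30 := sub_mul_signedSum_mono 3 0 k
  have h21 := sub_mul_signedSum_mono 2 1 k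
  have h31 := sub_mul_signedSum_mono 3 1 k
  have h32 := sub_mul_signedSum_mono 3 2 k
  generalize signedSum k (fun a => mono 0 a * mono 1 (k - a)) = s01 at *
  generalize signedSum k (fun a => mono 0 a * mono 2 (k - a)) = s02 at *
  generalize signedSum k (fun a => mono 0 a * mono 3 (k - a)) = s03 at *
  generalize signedSum k (fun a => mono 1 a * mono 2 (k - a)) = s12 at *
  generalize signedSum k (fun a => mono 1 a * mono 3 (k - a)) = s13 at *
  generalize signedSum k (fun a => mono 2 a * mono 3 (k - a)) = s23 at *
  generalize signedSum k (fun a => mono 1 a * mono 0 (k - a)) = s10 at *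
  generalize signedSum k (fun a => mono 2 a * mono 0 (k - a)) = s20 at *
  generalize signedSum k (fun a => mono 3 a * mono 0 (k - a)) = s30 at *
  generalize signedSum k (fun a => mono 2 a * mono 1 (k - a)) = s21 at *
  generalize signedSum k (fun a => mono 3 a * mono 1 (k - a)) = s31 at *
  generalize signedSum k (fun a => mono 3 a * mono 2 (k - a)) = s32 at *
  have e : ∀ i, euler i (mono i 1) = mono i 1 := fun i => by rw [euler_mono_self]; simp
  have e' : ∀ {i j : Fin 4}, i ≠ j → euler i (mono j 1) = 0 := fun h => euler_mono_of_ne h 1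
  rw [vander_eq_prod]
  simp only [Derivation.leibniz, map_sub, smul_eq_mul, e, e' (show (0 : Fin 4) ≠ 1 by decide),
    e' (show (0 : Fin 4) ≠ 2 by decide), e' (show (0 : Fin 4) ≠ 3 by decide),
    e' (show (1 : Fin 4) ≠ 0 by decide), e' (show (1 : Fin 4) ≠ 2 by decide),
    e' (show (1 : Fin 4) ≠ 3 by decide), e' (show (2 : Fin 4) ≠ 0 by decide),
    e' (show (2 : Fin 4) ≠ 1 by decide), e' (show (2 : Fin 4) ≠ 3 by decide),
    e' (show (3 : Fin 4) ≠ 0 by decide), e' (show (3 : Fin 4) ≠ 1 by decide),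
    e' (show (3 : Fin 4) ≠ 2 by decide)]
  generalize mono 0 1 = x0 at *
  generalize mono 1 1 = x1 at *
  generalize mono 2 1 = x2 at *
  generalize mono 3 1 = x3 at *
  generalize mono 0 k = w0 at *
  generalize mono 1 k = w1 at *
  generalize mono 2 k = w2 at *
  generalize mono 3 k = w3 at *
  linear_combination
    (x2 - x0) * (x3 - x0) * (x2 - x1) * (x3 - x1) * (x3 - x2) * (h01 - h10) +
    (x1 - x0) * (x3 - x0) * (x2 - x1) * (x3 - x1) * (x3 - x2) * (h02 - h20) +
    (x1 - x0) * (x2 - x0) * (x2 - x1) * (x3 - x1) * (x3 - x2) * (h03 - h30) +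
    (x1 - x0) * (x2 - x0) * (x3 - x0) * (x3 - x1) * (x3 - x2) * (h12 - h21) +
    (x1 - x0) * (x2 - x0) * (x3 - x0) * (x2 - x1) * (x3 - x2) * (h13 - h31) +
    (x1 - x0) * (x2 - x0) * (x3 - x0) * (x2 - x1) * (x3 - x1) * (h23 - h32)

/-- The radial part of the Laplacian is conjugate to the flat Laplacian. -/
theorem vander_mul_toLaurent_laplacian (f : TracePoly) :
    vander * toLaurent (laplacian f) = flatLap (vander * toLaurent f) := by
  induction f using MvPolynomial.induction_on with
  | C a =>
    have : vander * toLaurent (MvPolynomial.C a) = a • vander := by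
      rw [toLaurent, MvPolynomial.aeval_C, mul_comm, Algebra.smul_def]
    rw [laplacian_C, map_zero, mul_zero, this, map_smul, flatLap_vander, smul_zero]
  | add p q hp hq => simp only [map_add, mul_add, hp, hq]
  | mul_X p k hp =>
    have hV := two_mul_sum_mono_mul_euler_vander k
    have hS := sum_mono_mul_euler_toLaurent k p
    have hD : ∑ i, mono i k * euler i (vander * toLaurent p) =
        vander * ∑ i, mono i k * euler i (toLaurent p) +
        toLaurent p * ∑ i, mono i k * euler i vander := by
      simp only [Derivation.leibniz, smul_eq_mul, Finset.mul_sum, ← Finset.sum_add_distrib]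
      refine Finset.sum_congr rfl fun i _ => ?_
      ring
    rw [mul_comm p, laplacian_X_mul, map_mul toLaurent (MvPolynomial.X k), toLaurent_X,
      mul_left_comm, flatLap_powSum_mul, hD,
      hS, ← hp]
    simp only [map_add, map_mul, toLaurent_X, map_intCast, map_ofNat]
    linear_combination (-(k : Laurent)) * toLaurent p * hV

/-! ### Eigenvalues and power traces -/

theorem det_aeval_eq_prod_roots {n : Type*} [Fintype n] [DecidableEq n] (A : Matrix n n ℂ)
    (p : Polynomial ℂ) :
    (Polynomial.aeval A p).det = (A.charpoly.roots.map fun r => p.eval r).prod := by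
  have hcard : A.charpoly.roots.card = Fintype.card n := by
    rw [← (IsAlgClosed.splits A.charpoly).natDegree_eq_card_roots, Matrix.charpoly_natDegree_eq_dim]
  have hlin : ∀ r : ℂ, (A - algebraMap ℂ _ r).det = (A.charpoly.roots.map fun u => u - r).prod := by
    intro r
    have h1 : A.charpoly.eval r = (A.charpoly.roots.map fun u => r - u).prod := by
      conv_lhs => rw [(IsAlgClosed.splits A.charpoly).eq_prod_roots_of_monic A.charpoly_monic]
      rw [Polynomial.eval_multiset_prod, Multiset.map_map]
      simp
    have h2 : A - algebraMap ℂ _ r = -(Matrix.scalar n r - A) := by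
      rw [neg_sub]; rfl
    rw [h2, Matrix.det_neg, ← Matrix.eval_charpoly, h1, ← hcard, ← Multiset.card_map (fun u => r - u),
      ← Multiset.prod_map_neg, Multiset.map_map]
    simp
  conv_lhs => rw [(IsAlgClosed.splits p).eq_prod_roots]
  conv_rhs => rw [(IsAlgClosed.splits p).eq_prod_roots]
  rw [map_mul, Polynomial.aeval_C, Matrix.det_mul]
  have h3 : ∀ s : Multiset ℂ,
      (Polynomial.aeval A (s.map fun a => Polynomial.X - Polynomial.C a).prod).det =
      (A.charpoly.roots.map fun r =>
        Polynomial.eval r (s.map fun a => Polynomial.X - Polynomial.C a).prod).prod := by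
    intro s
    induction s using Multiset.induction_on with
    | empty => simp
    | cons a s ih =>
      simp only [Multiset.map_cons, Multiset.prod_cons, map_mul, Matrix.det_mul, ih,
        Polynomial.eval_mul, Multiset.prod_map_mul]
      rw [map_sub, Polynomial.aeval_X, Polynomial.aeval_C, hlin]
      simp
  simp only [Polynomial.eval_mul, Multiset.prod_map_mul, h3, Polynomial.eval_C,
    Multiset.map_const', Multiset.prod_replicate, hcard]
  congr 1
  rw [Algebra.algebraMap_eq_smul_one, Matrix.det_smul, Matrix.det_one, mul_one]

theorem trace_pow_eq_sum_roots {n : Type*} [Fintype n] [DecidableEq n] (A : Matrix n n ℂ) (k : ℕ) :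
    (A ^ k).trace = (A.charpoly.roots.map fun r => r ^ k).sum := by
  have h : (A ^ k).charpoly = ((A.charpoly.roots.map fun r => r ^ k).map
      fun a => Polynomial.X - Polynomial.C a).prod := by
    refine Polynomial.funext fun x => ?_
    rw [Matrix.eval_charpoly, Polynomial.eval_multiset_prod, Multiset.map_map, Multiset.map_map]
    have := det_aeval_eq_prod_roots A (Polynomial.C x - Polynomial.X ^ k)
    rw [map_sub, map_pow, Polynomial.aeval_X, Polynomial.aeval_C] at this
    rw [show (Matrix.scalar n) x = algebraMap ℂ (Matrix n n ℂ) x from rfl, this]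
    simp
  rw [Matrix.trace_eq_sum_roots_charpoly, h, Polynomial.roots_multiset_prod_X_sub_C]

section

open scoped Matrix.Norms.L2Operator

theorem norm_eq_one_of_mem_roots_charpoly {N : ℕ} (U : Matrix.unitaryGroup (Fin N) ℂ) {r : ℂ}
    (hr : r ∈ U.1.charpoly.roots) : ‖r‖ = 1 := by
  refine spectrum.norm_eq_one_of_unitary (E := Matrix (Fin N) (Fin N) ℂ) (𝕜 := ℂ) U.2 ?_
  rw [Matrix.mem_spectrum_iff_isRoot_charpoly]
  exact (Polynomial.mem_roots'.mp hr).2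

end

theorem exists_eigenvalues {N : ℕ} (U : Matrix.unitaryGroup (Fin N) ℂ) :
    ∃ u : Fin N → Circle, U.1.charpoly.roots = Finset.univ.val.map fun i => (u i : ℂ) := by
  have hlen : U.1.charpoly.roots.toList.length = N := by
    rw [Multiset.length_toList, ← (IsAlgClosed.splits U.1.charpoly).natDegree_eq_card_roots,
      Matrix.charpoly_natDegree_eq_dim, Fintype.card_fin]
  refine ⟨fun i => ⟨U.1.charpoly.roots.toList.get (i.cast hlen.symm), ?_⟩, ?_⟩
  · refine mem_sphere_zero_iff_norm.mpr ?_
    exact norm_eq_one_of_mem_roots_charpoly U (Multiset.mem_toList.mp (List.get_mem _ _))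
  · rw [Fin.univ_val_map]
    conv_lhs => rw [← Multiset.coe_toList U.1.charpoly.roots]
    congr 1
    refine List.ext_get (by simp [hlen]) fun n h1 h2 => ?_
    simp

theorem powTrace_eq_sum {N : ℕ} (U : Matrix.unitaryGroup (Fin N) ℂ) (u : Fin N → Circle)
    (hu : U.1.charpoly.roots = Finset.univ.val.map fun i => (u i : ℂ)) (k : ℤ) :
    powTrace U k = ∑ i, ((u i ^ k : Circle) : ℂ) := by
  have hnat : ∀ n : ℕ, powTrace U n = ∑ i, ((u i ^ n : Circle) : ℂ) := by
    intro n
    rw [powTrace, zpow_natCast, SubmonoidClass.coe_pow, trace_pow_eq_sum_roots, hu,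
      Multiset.map_map]
    simp [Finset.sum]
  rcases Int.eq_nat_or_neg k with ⟨n, rfl | rfl⟩
  · simpa using hnat n
  · have h : powTrace U (-n) = star (powTrace U n) := by
      rw [powTrace, powTrace, zpow_neg, ← Matrix.trace_conjTranspose]
      rfl
    rw [h, hnat]
    simp [← Circle.coe_inv_eq_conj]

namespace Laurent

/-! ### Antisymmetry -/

/-- Permuting the variables of a Laurent polynomial. -/
noncomputable def permAct (σ : Equiv.Perm (Fin 4)) : Laurent ≃ₐ[ℂ] Laurent :=
  AddMonoidAlgebra.domCongr ℂ ℂ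
    { toFun := fun m : Fin 4 → ℤ => m ∘ σ
      invFun := fun m => m ∘ σ.symm
      left_inv := fun m => by ext; simp
      right_inv := fun m => by ext; simp
      map_add' := fun _ _ => rfl }

theorem permAct_single (σ : Equiv.Perm (Fin 4)) (m : Fin 4 → ℤ) (a : ℂ) :
    permAct σ (AddMonoidAlgebra.single m a) = AddMonoidAlgebra.single (m ∘ σ) a := by
  simp [permAct]

theorem coeff_permAct (σ : Equiv.Perm (Fin 4)) (x : Laurent) (m : Fin 4 → ℤ) :
    (permAct σ x).coeff (m ∘ σ) = x.coeff m := by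
  classical
  induction x using induction_linear with
  | zero => simp
  | add x y hx hy => simp [hx, hy]
  | single n a =>
    rw [permAct_single, AddMonoidAlgebra.coeff_single, AddMonoidAlgebra.coeff_single,
      Finsupp.single_apply, Finsupp.single_apply]
    simp only [σ.surjective.injective_comp_right.eq_iff]

theorem permAct_powSum (σ : Equiv.Perm (Fin 4)) (k : ℤ) : permAct σ (powSum k) = powSum k := by
  rw [powSum, map_sum, ← Equiv.sum_comp σ]
  refine Finset.sum_congr rfl fun i _ => ?_
  rw [mono, permAct_single, mono]
  congr 1
  ext j
  simp [Pi.single_apply]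

theorem permAct_vander (σ : Equiv.Perm (Fin 4)) :
    permAct σ vander = ((Equiv.Perm.sign σ : ℤ) : ℂ) • vander := by
  rw [vander, map_sum, Finset.smul_sum]
  refine Fintype.sum_equiv (Equiv.mulRight σ) _ _ fun τ => ?_
  rw [permAct_single, AddMonoidAlgebra.smul_single', Equiv.coe_mulRight, Equiv.Perm.sign_mul,
    ← Int.cast_mul, ← Units.val_mul, mul_comm, mul_assoc, Int.units_mul_self, mul_one]
  rfl

/-- A Laurent polynomial is antisymmetric if permuting variables multiplies it by the sign. -/
def IsAntisymm (x : Laurent) : Prop :=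
  ∀ (σ : Equiv.Perm (Fin 4)) (m : Fin 4 → ℤ),
    x.coeff (m ∘ σ) = ((Equiv.Perm.sign σ : ℤ) : ℂ) * x.coeff m

theorem isAntisymm_vander_mul {y : Laurent} (hy : ∀ σ, permAct σ y = y) :
    IsAntisymm (vander * y) := by
  intro σ m
  have h : permAct σ (vander * y) = ((Equiv.Perm.sign σ : ℤ) : ℂ) • (vander * y) := by
    rw [map_mul, hy, permAct_vander, smul_mul_assoc]
  have h2 := coeff_permAct σ (vander * y) m
  rw [h, AddMonoidAlgebra.coeff_smul_apply, smul_eq_mul] at h2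
  rw [← h2, ← mul_assoc, ← Int.cast_mul, ← Units.val_mul, Int.units_mul_self]
  simp

theorem IsAntisymm.coeff_eq_zero {x : Laurent} (hx : IsAntisymm x) {m : Fin 4 → ℤ}
    (hm : ¬ Function.Injective m) : x.coeff m = 0 := by
  rw [Function.not_injective_iff] at hm
  obtain ⟨i, j, hij, hne⟩ := hm
  have h := hx (Equiv.swap i j) m
  have hc : m ∘ Equiv.swap i j = m := by
    ext l
    simp only [Function.comp_apply, Equiv.swap_apply_def]
    split_ifs with h1 h2 <;> simp [*]
  rw [hc, Equiv.Perm.sign_swap hne] at h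
  simp only [Units.val_neg, Units.val_one, Int.cast_neg, Int.cast_one, neg_mul, one_mul] at h
  exact self_eq_neg.mp h

theorem exists_perm_of_casimir_eq_zero {m : Fin 4 → ℤ} (hm : Function.Injective m)
    (h : casimir m = 0) : ∃ σ : Equiv.Perm (Fin 4), m = fun i => ((σ i : ℕ) : ℤ) := by
  have h0 : ∀ n : ℤ, 0 ≤ n ^ 2 - 3 * n + 2 := by
    intro n
    rcases le_or_gt n 1 with hn | hn <;> nlinarith
  have hb : ∀ i, m i ^ 2 - 3 * m i + 2 ≤ 4 := by
    intro i
    have h1 : ∑ i, (m i ^ 2 - 3 * m i + 2) = 4 := by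
      rw [Finset.sum_add_distrib]
      simp only [casimir] at h
      simp only [Finset.sum_const, Finset.card_univ, Fintype.card_fin, nsmul_eq_mul]
      push_cast
      linarith
    rw [← h1]
    exact Finset.single_le_sum (f := fun i => m i ^ 2 - 3 * m i + 2) (fun j _ => h0 (m j))
      (Finset.mem_univ i)
  have hr : ∀ i, 0 ≤ m i ∧ m i < 4 := by
    intro i
    have := hb i
    constructor <;> by_contra! hc <;> nlinarith
  have hinj : Function.Injective fun i => (⟨(m i).toNat, by have := hr i; omega⟩ : Fin 4) := by
    intro i j hij
    have := hr i
    have := hr j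
    apply hm
    have h2 : (m i).toNat = (m j).toNat := congrArg Fin.val hij
    omega
  refine ⟨Equiv.ofBijective _ (Finite.injective_iff_bijective.mp hinj), ?_⟩
  ext i
  have := hr i
  simp [this.1]

theorem coeff_vander (σ : Equiv.Perm (Fin 4)) :
    vander.coeff (fun i => ((σ i : ℕ) : ℤ)) = ((Equiv.Perm.sign σ : ℤ) : ℂ) := by
  classical
  rw [vander, AddMonoidAlgebra.coeff_sum, Finsupp.finsetSum_apply, Finset.sum_eq_single σ]
  · simp
  · intro τ _ hτ
    rw [AddMonoidAlgebra.coeff_single, Finsupp.single_apply, if_neg]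
    intro h
    apply hτ
    ext i
    have := congrFun h i
    simpa using this
  · simp

theorem vander_ne_zero : vander ≠ 0 := by
  intro h
  have := coeff_vander 1
  simp [h] at this

theorem IsAntisymm.eq_smul_vander {x : Laurent} (hx : IsAntisymm x)
    (h : ∀ m, x.coeff m ≠ 0 → casimir m = 0) :
    x = x.coeff (fun i => ((i : ℕ) : ℤ)) • vander := by
  have hv : IsAntisymm vander := by
    simpa using isAntisymm_vander_mul (y := 1) fun σ => map_one _
  ext m
  rw [AddMonoidAlgebra.coeff_smul_apply, smul_eq_mul]
  by_cases hm : ∃ σ : Equiv.Perm (Fin 4), m = fun i => ((σ i : ℕ) : ℤ)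
  · obtain ⟨σ, rfl⟩ := hm
    rw [coeff_vander]
    have := hx σ fun i => ((i : ℕ) : ℤ)
    rw [mul_comm, ← this]
    rfl
  · have key : ∀ y : Laurent, IsAntisymm y → (y.coeff m ≠ 0 → casimir m = 0) → y.coeff m = 0 := by
      intro y hy hc
      by_contra hne
      have hinj : Function.Injective m := by
        by_contra hni
        exact hne (hy.coeff_eq_zero hni)
      exact hm (exists_perm_of_casimir_eq_zero hinj (hc hne))
    rw [key x hx (h m), key vander hv, mul_zero]
    intro hne
    have := coeff_diagOp (fun m => (casimir m : ℂ)) vander m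
    rw [← flatLap, flatLap_vander] at this
    simpa [hne] using this.symm

/-- The pairing with the Vandermonde determinant. -/
noncomputable def pairing (x : Laurent) : ℂ :=
  (∑ σ : Equiv.Perm (Fin 4), ((Equiv.Perm.sign σ : ℤ) : ℂ) * x.coeff fun i => ((σ i : ℕ) : ℤ)) / 24

theorem pairing_vander : pairing vander = 1 := by
  simp only [pairing, coeff_vander, ← Int.cast_mul, ← Units.val_mul, Int.units_mul_self]
  simp [Fintype.card_perm, Nat.factorial]

theorem pairing_smul (c : ℂ) (x : Laurent) : pairing (c • x) = c * pairing x := by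
  simp only [pairing, AddMonoidAlgebra.coeff_smul_apply, smul_eq_mul, mul_div_assoc',
    Finset.mul_sum]
  congr 1
  refine Finset.sum_congr rfl fun σ _ => ?_
  ring

theorem pairing_flatLap (x : Laurent) : pairing (flatLap x) = 0 := by
  simp [pairing, flatLap, coeff_diagOp, casimir_perm]

theorem pairing_sub (x y : Laurent) : pairing (x - y) = pairing x - pairing y := by
  simp [pairing, mul_sub, Finset.sum_sub_distrib, sub_div]

/-- Evaluation of a Laurent polynomial at a point of the torus. -/
noncomputable def evalAt (u : Fin 4 → Circle) : Laurent →ₐ[ℂ] ℂ :=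
  AddMonoidAlgebra.lift ℂ ℂ (Fin 4 → ℤ)
    { toFun := fun m => ((∏ i, u i ^ (m.toAdd i) : Circle) : ℂ)
      map_one' := by simp
      map_mul' := fun m n => by simp [zpow_add, Finset.prod_mul_distrib] }

theorem evalAt_single (u : Fin 4 → Circle) (m : Fin 4 → ℤ) (a : ℂ) :
    evalAt u (AddMonoidAlgebra.single m a) = a * ((∏ i, u i ^ m i : Circle) : ℂ) := by
  simp [evalAt]

theorem evalAt_powSum (u : Fin 4 → Circle) (k : ℤ) :
    evalAt u (powSum k) = ∑ i, ((u i ^ k : Circle) : ℂ) := by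
  rw [powSum, map_sum]
  refine Finset.sum_congr rfl fun i _ => ?_
  rw [mono, evalAt_single, one_mul, Finset.prod_eq_single i]
  · simp
  · intro j _ hj; simp [hj]
  · simp

end Laurent

theorem permAct_toLaurent (σ : Equiv.Perm (Fin 4)) (f : TracePoly) :
    permAct σ (toLaurent f) = toLaurent f := by
  have h : (permAct σ).toAlgHom.comp toLaurent = toLaurent := by
    refine MvPolynomial.algHom_ext fun k => ?_
    simpa [toLaurent_X] using permAct_powSum σ k
  exact DFunLike.congr_fun h f

theorem eval_powTrace_eq_evalAt (U : Matrix.unitaryGroup (Fin 4) ℂ) (u : Fin 4 → Circle)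
    (hu : U.1.charpoly.roots = Finset.univ.val.map fun i => (u i : ℂ)) (f : TracePoly) :
    MvPolynomial.eval (powTrace U) f = evalAt u (toLaurent f) := by
  have h : (evalAt u).comp toLaurent = MvPolynomial.aeval (powTrace U) := by
    refine MvPolynomial.algHom_ext fun k => ?_
    rw [AlgHom.comp_apply, toLaurent_X, evalAt_powSum, MvPolynomial.aeval_X, powTrace_eq_sum U u hu]
  rw [← AlgHom.comp_apply, h]
  rfl

/-- The moments of the circular unitary ensemble. -/
theorem integral_eval_powTrace (f : TracePoly) :
    ∫ U, MvPolynomial.eval (powTrace U) f ∂(cue 4) = pairing (vander * toLaurent f) := by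
  suffices H : ∀ (n : ℕ) (f : TracePoly),
      (((vander * toLaurent f).coeff.support.image casimir).erase 0).card = n →
      ∫ U, MvPolynomial.eval (powTrace U) f ∂(cue 4) = pairing (vander * toLaurent f) from H _ f rfl
  intro n
  induction n using Nat.strong_induction_on with
  | _ n ih =>
    intro f hf
    by_cases hS : (((vander * toLaurent f).coeff.support.image casimir).erase 0).Nonempty
    · obtain ⟨c, hc⟩ := hS
      have hc0 : c ≠ 0 := Finset.ne_of_mem_erase hc
      have hcC : (c : ℂ) ≠ 0 := by exact_mod_cast hc0
      set g : TracePoly := laplacian f - (c : ℂ) • f with hg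
      have hG : vander * toLaurent g =
          flatLap (vander * toLaurent f) - (c : ℂ) • (vander * toLaurent f) := by
        rw [hg, map_sub, map_smul, mul_sub, vander_mul_toLaurent_laplacian, mul_smul_comm]
      have hcoeff : ∀ m, (vander * toLaurent g).coeff m =
          ((casimir m : ℂ) - c) * (vander * toLaurent f).coeff m := by
        intro m
        rw [hG, AddMonoidAlgebra.coeff_sub, Finsupp.sub_apply, flatLap, coeff_diagOp,
          AddMonoidAlgebra.coeff_smul_apply, smul_eq_mul]
        ring
      have hlt : (((vander * toLaurent g).coeff.support.image casimir).erase 0).card < n := by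
        rw [← hf]
        refine Finset.card_lt_card ((Finset.ssubset_iff_of_subset ?_).mpr ⟨c, hc, ?_⟩)
        · refine Finset.erase_subset_erase 0 (Finset.image_subset_image fun m hm => ?_)
          rw [Finsupp.mem_support_iff] at hm ⊢
          intro h0
          exact hm (by rw [hcoeff, h0, mul_zero])
        · intro hmem
          obtain ⟨m, hm, hmc⟩ := Finset.mem_image.mp (Finset.mem_of_mem_erase hmem)
          rw [Finsupp.mem_support_iff, hcoeff, hmc, sub_self, zero_mul] at hm
          exact hm rfl
      have h1 := ih _ hlt g rfl
      have h2 : ∫ U, MvPolynomial.eval (powTrace U) g ∂(cue 4) =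
          -((c : ℂ) * ∫ U, MvPolynomial.eval (powTrace U) f ∂(cue 4)) := by
        simp only [hg, map_sub, MvPolynomial.smul_eval]
        rw [integral_sub (integrable_cue_of_continuous (continuous_eval_powTrace _))
          ((integrable_cue_of_continuous (continuous_eval_powTrace _)).const_mul _),
          integral_laplacian, integral_const_mul, zero_sub]
      rw [h2, hG, pairing_sub, pairing_flatLap, pairing_smul, zero_sub, neg_inj] at h1
      exact mul_left_cancel₀ hcC h1
    · rw [Finset.not_nonempty_iff_eq_empty] at hS
      have hanti := isAntisymm_vander_mul fun σ => permAct_toLaurent σ f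
      have heq := hanti.eq_smul_vander fun m hm => by
        by_contra hne
        have : casimir m ∈ ((vander * toLaurent f).coeff.support.image casimir).erase 0 :=
          Finset.mem_erase.mpr ⟨hne, Finset.mem_image_of_mem _ (Finsupp.mem_support_iff.mpr hm)⟩
        rw [hS] at this
        exact absurd this (Finset.notMem_empty _)
      generalize (vander * toLaurent f).coeff (fun i => ((i : ℕ) : ℤ)) = c at heq
      have hf' : toLaurent f = algebraMap ℂ Laurent c := by
        refine mul_left_cancel₀ vander_ne_zero ?_
        rw [heq, Algebra.smul_def, mul_comm]
      rw [heq, pairing_smul, pairing_vander, mul_one]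
      have hc : ∀ U : Matrix.unitaryGroup (Fin 4) ℂ, MvPolynomial.eval (powTrace U) f = c := by
        intro U
        obtain ⟨u, hu⟩ := exists_eigenvalues U
        rw [eval_powTrace_eq_evalAt U u hu, hf', AlgHom.commutes]
        rfl
      simp [hc]

/-! ### The Weyl density on the torus -/

/-- The box of phases `[0, 2π)⁴`. -/
def box : Set (Fin 4 → ℝ) := Set.univ.pi fun _ => Set.Ico 0 (2 * Real.pi)

/-- The point of the torus with given phases. -/
noncomputable def torusExp (θ : Fin 4 → ℝ) (i : Fin 4) : Circle := Circle.exp (θ i)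

/-- The squared modulus of the Vandermonde determinant of the points with given phases. -/
noncomputable def vanderSq (θ : Fin 4 → ℝ) : ℝ := Complex.normSq (evalAt (torusExp θ) vander)

/-- Weyl's eigenphase measure. -/
noncomputable def weyl : Measure (Fin 4 → ℝ) :=
  (volume.restrict box).withDensity fun θ =>
    ENNReal.ofReal (vanderSq θ / (24 * (2 * Real.pi) ^ 4))

theorem measurableSet_box : MeasurableSet box :=
  MeasurableSet.univ_pi fun _ => measurableSet_Ico

theorem circle_coe_prod {ι : Type*} (s : Finset ι) (f : ι → Circle) :
    ((∏ i ∈ s, f i : Circle) : ℂ) = ∏ i ∈ s, (f i : ℂ) :=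
  map_prod Circle.coeHom f s

theorem continuous_torusExp : Continuous torusExp :=
  continuous_pi fun i => Circle.exp.continuous.comp (continuous_apply i)

theorem continuous_evalAt_torusExp (x : Laurent) : Continuous fun θ => evalAt (torusExp θ) x := by
  induction x using induction_linear with
  | zero => simpa using continuous_const
  | add x y hx hy =>
    simp only [map_add]
    exact hx.add hy
  | single m a =>
    simp only [evalAt_single]
    have h : Continuous fun θ : Fin 4 → ℝ => ∏ i, torusExp θ i ^ m i :=
      continuous_finsetProd _ fun i _ => (((continuous_apply i).comp continuous_torusExp).zpow _)
    exact continuous_const.mul (continuous_subtype_val.comp h)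

theorem continuous_vanderSq : Continuous vanderSq :=
  Complex.continuous_normSq.comp (continuous_evalAt_torusExp _)

theorem integrable_box_of_continuous {E : Type*} [NormedAddCommGroup E] {f : (Fin 4 → ℝ) → E}
    (hf : Continuous f) : Integrable f (volume.restrict box) := by
  have : IntegrableOn f (Set.univ.pi fun _ => Set.Icc 0 (2 * Real.pi)) volume :=
    hf.continuousOn.integrableOn_compact (isCompact_univ_pi fun _ => isCompact_Icc)
  exact this.mono_set (Set.pi_mono fun _ _ => Set.Ico_subset_Icc_self)

instance isFiniteMeasure_weyl : IsFiniteMeasure weyl :=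
  isFiniteMeasure_withDensity_ofReal
    (integrable_box_of_continuous (continuous_vanderSq.div_const _)).2

theorem integral_circleExp_zpow (k : ℤ) :
    ∫ t in Set.Ico 0 (2 * Real.pi), ((Circle.exp t ^ k : Circle) : ℂ) =
      if k = 0 then ((2 * Real.pi : ℝ) : ℂ) else 0 := by
  have h2 : (0 : ℝ) ≤ 2 * Real.pi := Real.two_pi_pos.le
  rw [integral_Ico_eq_integral_Ioc, ← intervalIntegral.integral_of_le h2]
  split_ifs with hk
  · simp [hk]
  · have h : ∀ t : ℝ, ((Circle.exp t ^ k : Circle) : ℂ) = Complex.exp ((k * Complex.I) * t) := by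
      intro t
      rw [Circle.coe_zpow, Circle.coe_exp, ← Complex.exp_int_mul]
      ring_nf
    have hc : (k * Complex.I : ℂ) ≠ 0 := by simp [hk]
    simp only [h]
    rw [integral_exp_mul_complex hc]
    have h1 : Complex.exp ((k * Complex.I) * ((2 * Real.pi : ℝ) : ℂ)) = 1 := by
      rw [Complex.exp_eq_one_iff]
      exact ⟨k, by push_cast; ring⟩
    rw [h1]
    simp

theorem integral_evalAt_torusExp (x : Laurent) :
    ∫ θ in box, evalAt (torusExp θ) x = (2 * Real.pi) ^ 4 * x.coeff 0 := by
  classical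
  induction x using induction_linear with
  | zero => simp
  | add x y hx hy =>
    simp only [map_add]
    rw [integral_add (integrable_box_of_continuous (continuous_evalAt_torusExp x))
      (integrable_box_of_continuous (continuous_evalAt_torusExp y)), hx, hy,
      AddMonoidAlgebra.coeff_add, Finsupp.add_apply]
    ring
  | single m a =>
    have hp : ∀ θ : Fin 4 → ℝ, ((∏ i, torusExp θ i ^ m i : Circle) : ℂ) =
        ∏ i, ((Circle.exp (θ i) ^ m i : Circle) : ℂ) := fun θ => circle_coe_prod _ _
    simp only [evalAt_single, hp]
    rw [integral_const_mul, box, volume_pi, Measure.restrict_pi_pi]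
    have := integral_fintype_prod_eq_prod (𝕜 := ℂ) (ι := Fin 4) (E := fun _ => ℝ)
      (μ := fun _ => (volume : Measure ℝ).restrict (Set.Ico 0 (2 * Real.pi)))
      (f := fun i t => ((Circle.exp t ^ m i : Circle) : ℂ))
    rw [this]
    simp only [integral_circleExp_zpow, AddMonoidAlgebra.coeff_single, Finsupp.single_apply]
    by_cases hm : m = 0
    · subst hm
      simp; ring
    · rw [if_neg hm]
      obtain ⟨i, hi⟩ := Function.ne_iff.mp hm
      rw [Finset.prod_eq_zero (Finset.mem_univ i) (if_neg hi)]
      simp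

theorem conj_evalAt_vander (u : Fin 4 → Circle) :
    (starRingEnd ℂ) (evalAt u vander) = evalAt u (∑ σ : Equiv.Perm (Fin 4),
      AddMonoidAlgebra.single (-fun i => ((σ i : ℕ) : ℤ)) ((Equiv.Perm.sign σ : ℤ) : ℂ)) := by
  rw [vander, map_sum, map_sum, map_sum]
  refine Finset.sum_congr rfl fun σ _ => ?_
  rw [evalAt_single, evalAt_single, map_mul, ← Circle.coe_inv_eq_conj, ← Finset.prod_inv_distrib]
  simp

/-- The moments of Weyl's eigenphase measure. -/
theorem integral_weyl (f : TracePoly) :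
    ∫ θ, evalAt (torusExp θ) (toLaurent f) ∂weyl = pairing (vander * toLaurent f) := by
  rw [weyl, integral_withDensity_eq_integral_toReal_smul
    (continuous_vanderSq.div_const _).measurable.ennreal_ofReal (ae_of_all _ fun _ => by simp)]
  have h : ∀ θ : Fin 4 → ℝ, (ENNReal.ofReal (vanderSq θ / (24 * (2 * Real.pi) ^ 4))).toReal •
      evalAt (torusExp θ) (toLaurent f) = (1 / (24 * (2 * Real.pi) ^ 4) : ℂ) *
      evalAt (torusExp θ) ((∑ σ : Equiv.Perm (Fin 4),
      AddMonoidAlgebra.single (-fun i => ((σ i : ℕ) : ℤ)) ((Equiv.Perm.sign σ : ℤ) : ℂ)) *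
        (vander * toLaurent f)) := by
    intro θ
    have hnn : 0 ≤ vanderSq θ / (24 * (2 * Real.pi) ^ 4) :=
      div_nonneg (Complex.normSq_nonneg _) (by positivity)
    rw [ENNReal.toReal_ofReal hnn, map_mul, map_mul, ← conj_evalAt_vander, ← mul_assoc,
      ← mul_assoc, mul_assoc _ ((starRingEnd ℂ) _), ← Complex.normSq_eq_conj_mul_self,
      Complex.real_smul, vanderSq]
    push_cast
    ring
  simp only [h]
  rw [integral_const_mul, integral_evalAt_torusExp, Finset.sum_mul, AddMonoidAlgebra.coeff_sum,
    Finsupp.finsetSum_apply, pairing]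
  have hπ : (Real.pi : ℂ) ≠ 0 := by exact_mod_cast Real.pi_ne_zero
  have hs : ∀ σ : Equiv.Perm (Fin 4), (AddMonoidAlgebra.single (-fun i => ((σ i : ℕ) : ℤ))
      ((Equiv.Perm.sign σ : ℤ) : ℂ) * (vander * toLaurent f)).coeff 0 =
      ((Equiv.Perm.sign σ : ℤ) : ℂ) * (vander * toLaurent f).coeff fun i => ((σ i : ℕ) : ℤ) := by
    intro σ
    refine AddMonoidAlgebra.coeff_single_mul_eq_mul_coeff _ fun m _ => ?_
    rw [neg_add_eq_zero, eq_comm]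
  simp only [hs]
  field_simp

/-! ### Equality of the laws of the power sums -/

/-- The first four power sums of a point of the torus. -/
noncomputable def powSums (u : Fin 4 → Circle) (j : Fin 4) : ℂ :=
  ∑ i, ((u i ^ ((j : ℕ) + 1) : Circle) : ℂ)

theorem norm_powSums_le (u : Fin 4 → Circle) : ‖powSums u‖ ≤ 4 := by
  refine (pi_norm_le_iff_of_nonneg (by norm_num)).mpr fun j => ?_
  refine (norm_sum_le _ _).trans ?_
  simp only [Circle.norm_coe]
  simp

theorem continuous_powSums : Continuous powSums :=
  continuous_pi fun _ => continuous_finsetSum _ fun i _ =>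
    continuous_subtype_val.comp ((continuous_apply i).pow _)

/-- The first four power traces of a unitary matrix. -/
noncomputable def powTraces (U : Matrix.unitaryGroup (Fin 4) ℂ) (j : Fin 4) : ℂ :=
  powTrace U ((j : ℕ) + 1 : ℕ)

theorem continuous_powTraces : Continuous powTraces :=
  continuous_pi fun _ => (continuous_coe_zpow _).matrix_trace

theorem powTraces_eq_powSums (U : Matrix.unitaryGroup (Fin 4) ℂ) (u : Fin 4 → Circle)
    (hu : U.1.charpoly.roots = Finset.univ.val.map fun i => (u i : ℂ)) :
    powTraces U = powSums u := by
  ext j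
  rw [powTraces, powTrace_eq_sum U u hu, powSums]
  simp only [zpow_natCast]

theorem exists_conj_evalAt (f : TracePoly) : ∃ g : TracePoly, ∀ u : Fin 4 → Circle,
    evalAt u (toLaurent g) = (starRingEnd ℂ) (evalAt u (toLaurent f)) := by
  induction f using MvPolynomial.induction_on with
  | C a =>
    refine ⟨MvPolynomial.C ((starRingEnd ℂ) a), fun u => ?_⟩
    rw [toLaurent, MvPolynomial.aeval_C, MvPolynomial.aeval_C, AlgHom.commutes, AlgHom.commutes]
    rfl
  | add p q hp hq =>
    obtain ⟨p', hp⟩ := hp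
    obtain ⟨q', hq⟩ := hq
    exact ⟨p' + q', fun u => by simp only [map_add, hp, hq]⟩
  | mul_X p k hp =>
    obtain ⟨p', hp⟩ := hp
    refine ⟨p' * MvPolynomial.X (-k), fun u => ?_⟩
    simp only [map_mul, hp, toLaurent_X, evalAt_powSum, map_sum, ← Circle.coe_inv_eq_conj, zpow_neg]

/-- The closed ball containing the vectors of power sums. -/
abbrev PowSumBall := Metric.closedBall (0 : Fin 4 → ℂ) 4

instance compactSpace_powSumBall : CompactSpace PowSumBall :=
  isCompact_iff_compactSpace.mp (isCompact_closedBall _ _)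

/-- The vector of power sums as an element of the ball. -/
noncomputable def powSumsBall (u : Fin 4 → Circle) : PowSumBall :=
  ⟨powSums u, by simpa using norm_powSums_le u⟩

/-- The vector of power traces as an element of the ball. -/
noncomputable def powTracesBall (U : Matrix.unitaryGroup (Fin 4) ℂ) : PowSumBall :=
  ⟨powTraces U, by
    obtain ⟨u, hu⟩ := exists_eigenvalues U
    simpa [powTraces_eq_powSums U u hu] using norm_powSums_le u⟩

/-- The coordinate functions on the ball. -/
noncomputable def powSumCoord (j : Fin 4) : BoundedContinuousFunction PowSumBall ℂ :=
  BoundedContinuousFunction.mkOfCompact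
    ⟨fun z => z.1 j, (continuous_apply j).comp continuous_subtype_val⟩

theorem exists_tracePoly_of_mem_adjoin {g : BoundedContinuousFunction PowSumBall ℂ}
    (hg : g ∈ StarAlgebra.adjoin ℂ (Set.range powSumCoord)) :
    ∃ f : TracePoly, ∀ u : Fin 4 → Circle, g (powSumsBall u) = evalAt u (toLaurent f) := by
  induction hg using StarAlgebra.adjoin_induction with
  | mem x hx =>
    obtain ⟨j, rfl⟩ := hx
    refine ⟨MvPolynomial.X ((j : ℕ) + 1 : ℕ), fun u => ?_⟩
    rw [toLaurent_X, evalAt_powSum]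
    simp only [zpow_natCast]
    rfl
  | algebraMap r =>
    refine ⟨MvPolynomial.C r, fun u => ?_⟩
    rw [toLaurent, MvPolynomial.aeval_C, AlgHom.commutes]
    simp [Algebra.algebraMap_eq_smul_one]
  | add x y _ _ hx hy =>
    obtain ⟨p, hp⟩ := hx
    obtain ⟨q, hq⟩ := hy
    exact ⟨p + q, fun u => by simp [hp, hq]⟩
  | mul x y _ _ hx hy =>
    obtain ⟨p, hp⟩ := hx
    obtain ⟨q, hq⟩ := hy
    exact ⟨p * q, fun u => by simp [hp, hq]⟩
  | star x _ hx =>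
    obtain ⟨p, hp⟩ := hx
    obtain ⟨q, hq⟩ := exists_conj_evalAt p
    exact ⟨q, fun u => by simp [hp, hq]⟩

theorem map_powTracesBall_cue :
    (cue 4).map powTracesBall = weyl.map fun θ => powSumsBall (torusExp θ) := by
  have hm1 : Measurable powTracesBall :=
    (continuous_powTraces.subtype_mk _).measurable
  have hm2 : Measurable fun θ => powSumsBall (torusExp θ) :=
    ((continuous_powSums.comp continuous_torusExp).subtype_mk _).measurable
  have hf1 : IsFiniteMeasure ((cue 4).map powTracesBall) :=
    Measure.isFiniteMeasure_map _ _
  have hf2 : IsFiniteMeasure (weyl.map fun θ => powSumsBall (torusExp θ)) :=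
    Measure.isFiniteMeasure_map _ _
  refine ext_of_forall_mem_subalgebra_integral_eq_of_pseudoEMetric_complete_countable (𝕜 := ℂ)
    (A := StarAlgebra.adjoin ℂ (Set.range powSumCoord)) ?_ ?_
  · intro x y hxy
    have : ∃ j, x.1 j ≠ y.1 j := by
      by_contra! h
      exact hxy (Subtype.ext (funext h))
    obtain ⟨j, hj⟩ := this
    refine ⟨fun z => z.1 j, ?_, hj⟩
    refine ⟨(powSumCoord j).toContinuousMap, ?_, rfl⟩
    exact ⟨powSumCoord j, StarAlgebra.subset_adjoin ℂ _ (Set.mem_range_self j), rfl⟩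
  · intro g hg
    obtain ⟨f, hf⟩ := exists_tracePoly_of_mem_adjoin hg
    rw [integral_map hm1.aemeasurable g.continuous.aestronglyMeasurable,
      integral_map hm2.aemeasurable g.continuous.aestronglyMeasurable]
    simp only [hf]
    rw [integral_weyl, ← integral_eval_powTrace]
    refine integral_congr_ae (ae_of_all _ fun U => ?_)
    obtain ⟨u, hu⟩ := exists_eigenvalues U
    have : powTracesBall U = powSumsBall u := Subtype.ext (powTraces_eq_powSums U u hu)
    simp only [this, hf, eval_powTrace_eq_evalAt U u hu]

/-- The law of the power traces under the circular unitary ensemble is the law of the power sums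
under Weyl's measure. -/
theorem map_powTraces_cue :
    (cue 4).map powTraces = weyl.map fun θ => powSums (torusExp θ) := by
  have hm1 : Measurable powTracesBall :=
    (continuous_powTraces.subtype_mk _).measurable
  have hm2 : Measurable fun θ => powSumsBall (torusExp θ) :=
    ((continuous_powSums.comp continuous_torusExp).subtype_mk _).measurable
  have h := congrArg (Measure.map Subtype.val) map_powTracesBall_cue
  rwa [Measure.map_map measurable_subtype_coe hm1, Measure.map_map measurable_subtype_coe hm2] at h

/-! ### Phases -/

theorem phase_mem (z : ℂ) : phase z ∈ Set.Ico 0 (2 * Real.pi) := by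
  simpa [phase] using toIcoMod_mem_Ico Real.two_pi_pos 0 z.arg

theorem circleExp_phase (z : Circle) : Circle.exp (phase z) = z := by
  rw [phase, toIcoMod, Circle.periodic_exp.sub_zsmul_eq, Circle.exp_arg]

theorem phase_circleExp {t : ℝ} (ht : t ∈ Set.Ico 0 (2 * Real.pi)) : phase (Circle.exp t) = t := by
  rw [phase, Circle.coe_exp, Complex.arg_exp_mul_I, toIcoMod_toIocMod, toIcoMod_eq_self]
  simpa using ht

/-- The minimal normalized spacing of an ordered list of phases. -/
noncomputable def minGap {N : ℕ} [NeZero N] (φ : Fin N → ℝ) : ℝ :=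
  Finset.univ.inf' Finset.univ_nonempty fun j : Fin N =>
    (if h : (j : ℕ) + 1 < N then φ ⟨j + 1, h⟩ - φ j else 2 * Real.pi + φ ⟨0, j.pos⟩ - φ j) /
      (2 * Real.pi / N)

theorem sMin_eq_minGap {N : ℕ} [NeZero N] (A : Matrix (Fin N) (Fin N) ℂ) :
    sMin A = minGap (eigenphase A) := rfl

theorem continuous_minGap {N : ℕ} [NeZero N] : Continuous (minGap : (Fin N → ℝ) → ℝ) := by
  refine Continuous.finset_inf'_apply _ fun j _ => ?_
  split_ifs with h <;> fun_prop

/-- The non-decreasing lists of phases in `[0, 2π)`. -/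
def sortedBox : Set (Fin 4 → ℝ) := {θ ∈ box | Monotone θ}

theorem map_eigenphase {N : ℕ} (A : Matrix (Fin N) (Fin N) ℂ) :
    Finset.univ.val.map (eigenphase A) = A.charpoly.roots.map phase := by
  have h : List.ofFn (eigenphase A) = eigenphaseList A := by
    refine List.ext_get (by simp [length_eigenphaseList]) fun n h1 h2 => ?_
    simp [eigenphase]
  rw [Fin.univ_val_map, h, eigenphaseList, Multiset.sort_eq]

theorem monotone_eigenphase {N : ℕ} (A : Matrix (Fin N) (Fin N) ℂ) : Monotone (eigenphase A) := by
  have h := List.pairwise_iff_get.mp (Multiset.pairwise_sort (A.charpoly.roots.map phase) (· ≤ ·))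
  intro i j hij
  rcases hij.eq_or_lt with rfl | hlt
  · exact le_rfl
  · exact h _ _ hlt

theorem eigenphase_mem_sortedBox (A : Matrix (Fin 4) (Fin 4) ℂ) : eigenphase A ∈ sortedBox := by
  refine ⟨fun i _ => ?_, monotone_eigenphase A⟩
  have h : eigenphase A i ∈ A.charpoly.roots.map phase := by
    rw [← map_eigenphase]
    exact Multiset.mem_map_of_mem _ (Finset.mem_univ_val i)
  obtain ⟨r, _, hr⟩ := Multiset.mem_map.mp h
  rw [← hr]
  exact phase_mem r

theorem roots_charpoly_eq_map_torusExp (U : Matrix.unitaryGroup (Fin 4) ℂ) :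
    U.1.charpoly.roots = Finset.univ.val.map fun i => (torusExp (eigenphase U.1) i : ℂ) := by
  have h : (Finset.univ.val.map fun i => (torusExp (eigenphase U.1) i : ℂ)) =
      (Finset.univ.val.map (eigenphase U.1)).map fun t => (Circle.exp t : ℂ) := by
    rw [Multiset.map_map]; rfl
  obtain ⟨u, hu⟩ := exists_eigenvalues U
  rw [h, map_eigenphase, hu, Multiset.map_map, Multiset.map_map]
  refine Multiset.map_congr rfl fun i _ => ?_
  simp only [Function.comp_apply, circleExp_phase]

theorem powTraces_eq (U : Matrix.unitaryGroup (Fin 4) ℂ) :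
    powTraces U = powSums (torusExp (eigenphase U.1)) :=
  powTraces_eq_powSums U _ (roots_charpoly_eq_map_torusExp U)

/-! ### Power sums determine points up to order -/

theorem map_eq_of_powSums_eq {u v : Fin 4 → Circle} (h : powSums u = powSums v) :
    (Finset.univ.val.map fun i => (u i : ℂ)) = Finset.univ.val.map fun i => (v i : ℂ) := by
  have h1 := congrFun h 0
  have h2 := congrFun h 1
  have h3 := congrFun h 2
  have h4 := congrFun h 3
  simp only [powSums, Fin.sum_univ_four, Circle.coe_pow] at h1 h2 h3 h4
  norm_num at h1 h2 h3 h4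
  have hpoly : ∀ w : Fin 4 → ℂ,
      ((Finset.univ.val.map fun i => w i).map fun a => Polynomial.X - Polynomial.C a).prod =
      Polynomial.X ^ 4 - Polynomial.C (w 0 + w 1 + w 2 + w 3) * Polynomial.X ^ 3 +
      Polynomial.C (((w 0 + w 1 + w 2 + w 3) ^ 2 -
        (w 0 ^ 2 + w 1 ^ 2 + w 2 ^ 2 + w 3 ^ 2)) / 2) * Polynomial.X ^ 2 -
      Polynomial.C (((w 0 + w 1 + w 2 + w 3) ^ 3 - 3 * (w 0 + w 1 + w 2 + w 3) *
        (w 0 ^ 2 + w 1 ^ 2 + w 2 ^ 2 + w 3 ^ 2) +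
        2 * (w 0 ^ 3 + w 1 ^ 3 + w 2 ^ 3 + w 3 ^ 3)) / 6) * Polynomial.X +
      Polynomial.C (((w 0 + w 1 + w 2 + w 3) ^ 4 - 6 * (w 0 + w 1 + w 2 + w 3) ^ 2 *
        (w 0 ^ 2 + w 1 ^ 2 + w 2 ^ 2 + w 3 ^ 2) + 3 * (w 0 ^ 2 + w 1 ^ 2 + w 2 ^ 2 + w 3 ^ 2) ^ 2 +
        8 * (w 0 + w 1 + w 2 + w 3) * (w 0 ^ 3 + w 1 ^ 3 + w 2 ^ 3 + w 3 ^ 3) -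
        6 * (w 0 ^ 4 + w 1 ^ 4 + w 2 ^ 4 + w 3 ^ 4)) / 24) := by
    intro w
    refine Polynomial.funext fun x => ?_
    rw [Multiset.map_map]
    change Polynomial.eval x (∏ i, (Polynomial.X - Polynomial.C (w i))) = _
    simp only [Fin.prod_univ_four, Polynomial.eval_mul, Polynomial.eval_sub, Polynomial.eval_add,
      Polynomial.eval_pow, Polynomial.eval_X, Polynomial.eval_C]
    ring
  rw [← Polynomial.roots_multiset_prod_X_sub_C (Finset.univ.val.map fun i => (u i : ℂ)),
    ← Polynomial.roots_multiset_prod_X_sub_C (Finset.univ.val.map fun i => (v i : ℂ)),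
    hpoly fun i => (u i : ℂ), hpoly fun i => (v i : ℂ)]
  simp only [h1, h2, h3, h4]

theorem injOn_powSums_torusExp : Set.InjOn (fun θ => powSums (torusExp θ)) sortedBox := by
  intro θ hθ η hη h
  have h1 := congrArg (Multiset.map phase) (map_eq_of_powSums_eq h)
  rw [Multiset.map_map, Multiset.map_map] at h1
  have h2 : ∀ ξ ∈ sortedBox, (Finset.univ.val.map (phase ∘ fun i => (torusExp ξ i : ℂ))) =
      ((List.ofFn ξ : List ℝ) : Multiset ℝ) := by
    intro ξ hξ
    rw [← Fin.univ_val_map]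
    refine Multiset.map_congr rfl fun i _ => ?_
    exact phase_circleExp (hξ.1 i trivial)
  rw [h2 θ hθ, h2 η hη, Multiset.coe_eq_coe] at h1
  have hs : ∀ ξ ∈ sortedBox, (List.ofFn ξ).Pairwise (· ≤ ·) := by
    intro ξ hξ
    rw [List.pairwise_ofFn]
    exact fun i j hij => hξ.2 hij.le
  exact List.ofFn_injective
    (h1.eq_of_pairwise (fun a b _ _ h h' => le_antisymm h h') (hs θ hθ) (hs η hη))

theorem measurableSet_sortedBox : MeasurableSet sortedBox := by
  refine measurableSet_box.inter (IsClosed.measurableSet ?_)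
  have : {θ : Fin 4 → ℝ | Monotone θ} = ⋂ (i) (j) (_ : i ≤ j), {θ | θ i ≤ θ j} := by
    ext θ; simp [Monotone]
  change IsClosed {θ : Fin 4 → ℝ | Monotone θ}
  rw [this]
  exact isClosed_iInter fun i => isClosed_iInter fun j => isClosed_iInter fun _ =>
    isClosed_le (continuous_apply i) (continuous_apply j)

/-- The power sums of the sorted lists of phases with minimal gap in `B`. -/
def gapImage (B : Set ℝ) : Set (Fin 4 → ℂ) :=
  (fun θ => powSums (torusExp θ)) '' (sortedBox ∩ minGap ⁻¹' B)

theorem measurableSet_gapImage {B : Set ℝ} (hB : MeasurableSet B) :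
    MeasurableSet (gapImage B) :=
  (measurableSet_sortedBox.inter (continuous_minGap.measurable hB)).image_of_continuousOn_injOn
    (continuous_powSums.comp continuous_torusExp).continuousOn
    (injOn_powSums_torusExp.mono Set.inter_subset_left)

theorem powSums_mem_gapImage_iff {B : Set ℝ} {θ : Fin 4 → ℝ} (hθ : θ ∈ sortedBox) :
    powSums (torusExp θ) ∈ gapImage B ↔ minGap θ ∈ B := by
  constructor
  · rintro ⟨η, ⟨hη, hB⟩, h⟩
    rwa [← injOn_powSums_torusExp hη hθ h]
  · exact fun h => ⟨θ, ⟨hθ, h⟩, rfl⟩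

theorem preimage_sMin (B : Set ℝ) :
    (fun U : Matrix.unitaryGroup (Fin 4) ℂ => sMin U.1) ⁻¹' B = powTraces ⁻¹' gapImage B := by
  ext U
  rw [Set.mem_preimage, Set.mem_preimage, powTraces_eq, sMin_eq_minGap,
    powSums_mem_gapImage_iff (eigenphase_mem_sortedBox U.1)]

theorem measurable_sMin : Measurable fun U : Matrix.unitaryGroup (Fin 4) ℂ => sMin U.1 := by
  intro B hB
  rw [preimage_sMin]
  exact continuous_powTraces.measurable (measurableSet_gapImage hB)

theorem map_sMin_apply {B : Set ℝ} (hB : MeasurableSet B) :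
    (cue 4).map (fun U : Matrix.unitaryGroup (Fin 4) ℂ => sMin U.1) B =
      weyl {θ | powSums (torusExp θ) ∈ gapImage B} := by
  rw [Measure.map_apply measurable_sMin hB, preimage_sMin,
    ← Measure.map_apply continuous_powTraces.measurable (measurableSet_gapImage hB),
    map_powTraces_cue]
  exact Measure.map_apply (continuous_powSums.comp continuous_torusExp).measurable
    (measurableSet_gapImage hB)

/-! ### Reduction to ordered phases -/

theorem evalAt_vander (u : Fin 4 → Circle) : evalAt u vander =
    ((u 1 : ℂ) - u 0) * (u 2 - u 0) * (u 3 - u 0) * (u 2 - u 1) * (u 3 - u 1) * (u 3 - u 2) := by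
  have h : ∀ i, evalAt u (mono i 1) = u i := by
    intro i
    rw [mono, evalAt_single, one_mul, Finset.prod_eq_single i]
    · simp
    · intro j _ hj; simp [hj]
    · simp
  rw [vander_eq_prod]
  simp only [map_mul, map_sub, h]

theorem evalAt_permAct (u : Fin 4 → Circle) (σ : Equiv.Perm (Fin 4)) (x : Laurent) :
    evalAt (u ∘ σ) (permAct σ x) = evalAt u x := by
  induction x using induction_linear with
  | zero => simp
  | add x y hx hy => simp only [map_add, hx, hy]
  | single m a =>
    rw [permAct_single, evalAt_single, evalAt_single]
    congr 2
    exact Equiv.prod_comp σ fun i => u i ^ m i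

theorem vanderSq_comp_perm (θ : Fin 4 → ℝ) (σ : Equiv.Perm (Fin 4)) :
    vanderSq (θ ∘ σ) = vanderSq θ := by
  have h := evalAt_permAct (torusExp θ) σ vander
  rw [permAct_vander, map_smul, smul_eq_mul] at h
  rw [vanderSq, vanderSq, ← h, map_mul]
  change Complex.normSq (evalAt (torusExp θ ∘ σ) vander) = _
  rcases Int.units_eq_one_or (Equiv.Perm.sign σ) with hs | hs <;> simp [hs]

theorem vanderSq_eq_zero {θ : Fin 4 → ℝ} (hθ : ¬ Function.Injective θ) : vanderSq θ = 0 := by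
  rw [Function.not_injective_iff] at hθ
  obtain ⟨i, j, hij, hne⟩ := hθ
  have hu : (torusExp θ i : ℂ) = torusExp θ j := by rw [torusExp, torusExp, hij]
  rw [vanderSq, evalAt_vander, map_eq_zero]
  fin_cases i <;> fin_cases j <;> first | exact absurd rfl hne | simp_all

/-- The increasing lists of phases in `[0, 2π)`. -/
def strictBox : Set (Fin 4 → ℝ) := {θ ∈ box | StrictMono θ}

theorem powSums_comp_perm (u : Fin 4 → Circle) (σ : Equiv.Perm (Fin 4)) :
    powSums (u ∘ σ) = powSums u := by
  ext j
  exact Equiv.sum_comp σ fun i => ((u i ^ ((j : ℕ) + 1) : Circle) : ℂ)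

theorem comp_perm_mem_box_iff {θ : Fin 4 → ℝ} (σ : Equiv.Perm (Fin 4)) :
    θ ∘ σ ∈ box ↔ θ ∈ box := by
  simp only [box, Set.mem_univ_pi, Function.comp_apply]
  exact ⟨fun h i => by simpa using h (σ.symm i), fun h i => h _⟩

theorem sum_indicator_comp_perm (B : Set ℝ) (θ : Fin 4 → ℝ) :
    ∑ σ : Equiv.Perm (Fin 4), (strictBox ∩ minGap ⁻¹' B).indicator
        (fun η => ENNReal.ofReal (vanderSq η)) (θ ∘ σ) =
      (box ∩ {θ | powSums (torusExp θ) ∈ gapImage B}).indicator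
        (fun η => ENNReal.ofReal (vanderSq η)) θ := by
  classical
  simp only [Set.indicator_apply, vanderSq_comp_perm]
  by_cases hinj : Function.Injective θ
  · have hmono := Tuple.monotone_sort θ
    have hstrict : StrictMono (θ ∘ Tuple.sort θ) :=
      hmono.strictMono_of_injective (hinj.comp (Tuple.sort θ).injective)
    rw [Finset.sum_eq_single (Tuple.sort θ)]
    · have hiff : θ ∘ Tuple.sort θ ∈ strictBox ∩ minGap ⁻¹' B ↔
          θ ∈ box ∩ {θ | powSums (torusExp θ) ∈ gapImage B} := by
        rw [Set.mem_inter_iff, Set.mem_inter_iff, strictBox, Set.mem_sep_iff,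
          comp_perm_mem_box_iff, and_iff_left hstrict]
        refine and_congr_right fun hb => ?_
        rw [Set.mem_preimage, ← powSums_mem_gapImage_iff
          ⟨(comp_perm_mem_box_iff (Tuple.sort θ)).mpr hb, hmono⟩, Set.mem_ofPred_eq,
          ← powSums_comp_perm (torusExp θ) (Tuple.sort θ)]
        rfl
      simp only [hiff]
    · intro τ _ hτ
      rw [if_neg]
      intro hmem
      apply hτ
      have h := Tuple.unique_monotone hmem.1.2.monotone hmono
      ext i
      exact congrArg Fin.val (hinj (congrFun h i))
    · simp
  · simp [vanderSq_eq_zero hinj]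

theorem measurableSet_strictBox : MeasurableSet strictBox := by
  have : {θ : Fin 4 → ℝ | StrictMono θ} = ⋂ (i) (j) (_ : i < j), {θ | θ i < θ j} := by
    ext θ; simp [StrictMono]
  refine measurableSet_box.inter ?_
  change MeasurableSet {θ : Fin 4 → ℝ | StrictMono θ}
  rw [this]
  exact MeasurableSet.iInter fun i => MeasurableSet.iInter fun j => MeasurableSet.iInter fun _ =>
    measurableSet_lt (measurable_pi_apply i) (measurable_pi_apply j)

theorem measurable_indicator_strictBox {B : Set ℝ} (hB : MeasurableSet B) :
    Measurable ((strictBox ∩ minGap ⁻¹' B).indicator fun η => ENNReal.ofReal (vanderSq η)) :=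
  continuous_vanderSq.measurable.ennreal_ofReal.indicator
    (measurableSet_strictBox.inter (continuous_minGap.measurable hB))

theorem map_sMin_eq_lintegral {B : Set ℝ} (hB : MeasurableSet B) :
    (cue 4).map (fun U : Matrix.unitaryGroup (Fin 4) ℂ => sMin U.1) B =
      ENNReal.ofReal (1 / (2 * Real.pi) ^ 4) * ∫⁻ θ, (strictBox ∩ minGap ⁻¹' B).indicator
        (fun η => ENNReal.ofReal (vanderSq η)) θ := by
  have hE : MeasurableSet {θ | powSums (torusExp θ) ∈ gapImage B} :=
    (continuous_powSums.comp continuous_torusExp).measurable (measurableSet_gapImage hB)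
  have hperm : ∀ σ : Equiv.Perm (Fin 4), ∫⁻ θ, (strictBox ∩ minGap ⁻¹' B).indicator
      (fun η => ENNReal.ofReal (vanderSq η)) (θ ∘ σ) = ∫⁻ θ, (strictBox ∩ minGap ⁻¹' B).indicator
      (fun η => ENNReal.ofReal (vanderSq η)) θ := by
    intro σ
    exact (volume_preserving_arrowCongr' σ.symm (MeasurableEquiv.refl ℝ)
      (MeasurePreserving.id _)).lintegral_comp (measurable_indicator_strictBox hB)
  have hmul : ∀ θ : Fin 4 → ℝ, ENNReal.ofReal (vanderSq θ / (24 * (2 * Real.pi) ^ 4)) =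
      ENNReal.ofReal (1 / (24 * (2 * Real.pi) ^ 4)) * ENNReal.ofReal (vanderSq θ) := by
    intro θ
    rw [← ENNReal.ofReal_mul (by positivity), one_div_mul_eq_div]
  rw [map_sMin_apply hB, weyl, withDensity_apply _ hE, Measure.restrict_restrict hE, Set.inter_comm]
  simp only [hmul]
  rw [lintegral_const_mul _ continuous_vanderSq.measurable.ennreal_ofReal,
    ← lintegral_indicator (measurableSet_box.inter hE)]
  simp only [← sum_indicator_comp_perm]
  rw [lintegral_finsetSum]
  · simp only [hperm, Finset.sum_const, Finset.card_univ, Fintype.card_perm, Fintype.card_fin,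
      nsmul_eq_mul]
    rw [← mul_assoc]
    congr 1
    rw [show ((Nat.factorial 4 : ℕ) : ENNReal) = ENNReal.ofReal 24 by
      norm_num [Nat.factorial], ← ENNReal.ofReal_mul (by positivity)]
    congr 1
    have := Real.pi_ne_zero
    field_simp
  · intro σ _
    exact (measurable_indicator_strictBox hB).comp
      (measurable_pi_lambda _ fun i => measurable_pi_apply (σ i))

/-! ### Iterated integrals -/

theorem lintegral_fin_succ {n : ℕ} {f : (Fin (n + 1) → ℝ) → ENNReal} (hf : Measurable f) :
    ∫⁻ θ, f θ = ∫⁻ a : ℝ, ∫⁻ η : Fin n → ℝ, f (Matrix.vecCons a η) := by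
  have h := (volume_preserving_piFinSuccAbove (fun _ : Fin (n + 1) => ℝ) 0).symm
  rw [← h.lintegral_comp hf, Measure.volume_eq_prod]
  refine (lintegral_prod (μ := volume) (ν := volume) _
    (hf.comp h.measurable).aemeasurable).trans ?_
  refine lintegral_congr fun a => lintegral_congr fun η => congrArg f (funext fun i => ?_)
  refine Fin.cases ?_ (fun j => ?_) i <;> rfl

theorem lintegral_fin_four {f : (Fin 4 → ℝ) → ENNReal} (hf : Measurable f) :
    ∫⁻ θ, f θ = ∫⁻ (a : ℝ) (b : ℝ) (c : ℝ) (d : ℝ), f ![a, b, c, d] := by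
  have hc : ∀ {n : ℕ} (a : ℝ), Measurable fun η : Fin n → ℝ => Matrix.vecCons a η := by
    intro n a
    refine measurable_pi_lambda _ fun i => ?_
    refine Fin.cases ?_ (fun j => ?_) i
    · exact measurable_const
    · exact measurable_pi_apply j
  rw [lintegral_fin_succ hf]
  refine lintegral_congr fun a => ?_
  refine (lintegral_fin_succ (hf.comp (hc a))).trans ?_
  refine lintegral_congr fun b => ?_
  refine (lintegral_fin_succ ((hf.comp (hc a)).comp (hc b))).trans ?_
  refine lintegral_congr fun c => ?_
  refine (lintegral_fin_succ (((hf.comp (hc a)).comp (hc b)).comp (hc c))).trans ?_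
  refine lintegral_congr fun d => ?_
  rw [lintegral_unique]
  simp only [Function.comp_apply]
  have h1 : (volume : Measure (Fin 0 → ℝ)) Set.univ = 1 := by
    simp [volume_pi]
  rw [h1, mul_one]
  congr 5

theorem lintegral_triple {g : ℝ × ℝ × ℝ → ENNReal} (hg : Measurable g) :
    ∫⁻ q, g q = ∫⁻ (x : ℝ) (y : ℝ) (z : ℝ), g (x, y, z) := by
  rw [Measure.volume_eq_prod, lintegral_prod _ hg.aemeasurable]
  refine lintegral_congr fun x => ?_
  exact lintegral_prod _ (hg.comp measurable_prodMk_left).aemeasurable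

/-! ### The gap variables -/

/-- The last gap, given the first three. -/
noncomputable def lastGap (q : ℝ × ℝ × ℝ) : ℝ := 2 * Real.pi - q.1 - q.2.1 - q.2.2

/-- The cyclic rotation of the four gaps. -/
noncomputable def rotGap (q : ℝ × ℝ × ℝ) : ℝ × ℝ × ℝ := (lastGap q, q.1, q.2.1)

/-- The squared length of the chord over an arc. -/
noncomputable def chord (t : ℝ) : ℝ := 2 - 2 * Real.cos t

/-- The squared Vandermonde determinant in terms of the gaps. -/
noncomputable def gapDensity (q : ℝ × ℝ × ℝ) : ℝ :=
  chord q.1 * chord q.2.1 * chord q.2.2 * chord (q.1 + q.2.1) * chord (q.2.1 + q.2.2) *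
    chord (q.1 + q.2.1 + q.2.2)

/-- The smallest of the four gaps. -/
noncomputable def smallGap (q : ℝ × ℝ × ℝ) : ℝ := min (min q.1 q.2.1) (min q.2.2 (lastGap q))

theorem continuous_lastGap : Continuous lastGap := by unfold lastGap; fun_prop

theorem continuous_rotGap : Continuous rotGap := by unfold rotGap lastGap; fun_prop

theorem continuous_gapDensity : Continuous gapDensity := by unfold gapDensity chord; fun_prop

theorem continuous_smallGap : Continuous smallGap := by unfold smallGap lastGap; fun_prop

theorem chord_two_pi_sub (t : ℝ) : chord (2 * Real.pi - t) = chord t := by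
  rw [chord, Real.cos_two_pi_sub, chord]

theorem gapDensity_rotGap (q : ℝ × ℝ × ℝ) : gapDensity (rotGap q) = gapDensity q := by
  obtain ⟨x, y, z⟩ := q
  simp only [gapDensity, rotGap, lastGap]
  rw [show 2 * Real.pi - x - y - z + x + y = 2 * Real.pi - z by ring,
    show 2 * Real.pi - x - y - z + x = 2 * Real.pi - (y + z) by ring,
    show 2 * Real.pi - x - y - z = 2 * Real.pi - (x + y + z) by ring]
  simp only [chord_two_pi_sub]
  ring

theorem lastGap_rotGap (q : ℝ × ℝ × ℝ) : lastGap (rotGap q) = q.2.2 := by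
  simp only [lastGap, rotGap]; ring

theorem lintegral_comp_rotGap {g : ℝ × ℝ × ℝ → ENNReal} (hg : Measurable g) :
    ∫⁻ q, g (rotGap q) = ∫⁻ q, g q := by
  refine (lintegral_triple (hg.comp continuous_rotGap.measurable)).trans ?_
  simp only [Function.comp_apply]
  have h : ∀ x y : ℝ, ∫⁻ z, g (rotGap (x, y, z)) = ∫⁻ t, g (t, x, y) := by
    intro x y
    have := lintegral_sub_left_eq_self (μ := (volume : Measure ℝ)) (fun t => g (t, x, y))
      (2 * Real.pi - x - y)
    simpa [rotGap, lastGap] using this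
  simp only [h]
  rw [Measure.volume_eq_prod, lintegral_prod_symm _ hg.aemeasurable, Measure.volume_eq_prod,
    lintegral_prod]
  exact (hg.lintegral_prod_left' (μ := (volume : Measure ℝ))).aemeasurable

/-! ### From phases to gaps -/

theorem normSq_circleExp_sub (s t : ℝ) :
    Complex.normSq ((Circle.exp s : ℂ) - Circle.exp t) = chord (s - t) := by
  rw [Circle.coe_exp, Circle.coe_exp, Complex.normSq_apply, chord, Real.cos_sub]
  simp only [Complex.sub_re, Complex.sub_im, Complex.exp_ofReal_mul_I_re,
    Complex.exp_ofReal_mul_I_im]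
  nlinarith [Real.sin_sq_add_cos_sq s, Real.sin_sq_add_cos_sq t]

theorem vanderSq_eq_gapDensity (a x y z : ℝ) :
    vanderSq ![a, a + x, a + x + y, a + x + y + z] = gapDensity (x, y, z) := by
  rw [vanderSq, evalAt_vander]
  simp only [map_mul, torusExp, normSq_circleExp_sub]
  simp only [Matrix.cons_val, gapDensity]
  rw [show a + x - a = x by ring, show a + x + y - a = x + y by ring,
    show a + x + y + z - a = x + y + z by ring, show a + x + y - (a + x) = y by ring,
    show a + x + y + z - (a + x) = y + z by ring, show a + x + y + z - (a + x + y) = z by ring]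
  ring

theorem minGap_eq_smallGap (a x y z : ℝ) :
    minGap ![a, a + x, a + x + y, a + x + y + z] = smallGap (x, y, z) / (Real.pi / 2) := by
  have hπ : (0 : ℝ) < 2 * Real.pi / (4 : ℕ) := by have := Real.pi_pos; positivity
  have h2 : Real.pi / 2 = 2 * Real.pi / (4 : ℕ) := by push_cast; ring
  refine eq_of_forall_le_iff fun c => ?_
  rw [minGap, Finset.le_inf'_iff, h2, le_div_iff₀ hπ]
  simp only [Finset.mem_univ, true_implies, le_div_iff₀ hπ, smallGap, lastGap, le_min_iff]
  generalize c * (2 * Real.pi / (4 : ℕ)) = d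
  simp only [Fin.forall_fin_succ]
  simp
  constructor
  · rintro ⟨h1, h2, h3, h4⟩
    exact ⟨⟨h1, by linarith⟩, by linarith, by linarith⟩
  · rintro ⟨⟨h1, h2⟩, h3, h4⟩
    exact ⟨h1, by linarith, by linarith, by linarith⟩

theorem mem_strictBox_iff (a x y z : ℝ) :
    ![a, a + x, a + x + y, a + x + y + z] ∈ strictBox ↔
      (0 < x ∧ 0 < y ∧ 0 < z) ∧ 0 ≤ a ∧ a < lastGap (x, y, z) := by
  have h : StrictMono ![a, a + x, a + x + y, a + x + y + z] ↔ 0 < x ∧ 0 < y ∧ 0 < z := by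
    rw [Fin.strictMono_iff_lt_succ]
    simp [Fin.forall_fin_succ]
  rw [strictBox, Set.mem_sep_iff, h, and_comm]
  refine and_congr_right fun ⟨hx, hy, hz⟩ => ?_
  simp only [box, Set.mem_univ_pi, Set.mem_Ico, Fin.forall_fin_succ, lastGap]
  simp
  constructor
  · rintro ⟨⟨h1, h2⟩, h3, h4, h5⟩
    exact ⟨h1, by linarith⟩
  · rintro ⟨h1, h2⟩
    refine ⟨⟨h1, ?_⟩, ⟨?_, ?_⟩, ⟨?_, ?_⟩, ?_, ?_⟩ <;> linarith

/-- The configurations of positive gaps whose smallest gap is admissible. -/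
def gapSet (B : Set ℝ) : Set (ℝ × ℝ × ℝ) :=
  {q | 0 < q.1 ∧ 0 < q.2.1 ∧ 0 < q.2.2 ∧ 0 < lastGap q ∧ smallGap q / (Real.pi / 2) ∈ B}

/-- The configurations whose last gap is the smallest one and is admissible. -/
def lowSet (B : Set ℝ) : Set (ℝ × ℝ × ℝ) :=
  {q | 0 < lastGap q ∧ lastGap q < q.1 ∧ lastGap q < q.2.1 ∧ lastGap q < q.2.2 ∧
    lastGap q / (Real.pi / 2) ∈ B}

theorem measurableSet_gapSet {B : Set ℝ} (hB : MeasurableSet B) : MeasurableSet (gapSet B) := by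
  have h1 : MeasurableSet {q : ℝ × ℝ × ℝ | 0 < q.1} :=
    measurableSet_lt measurable_const measurable_fst
  have h2 : MeasurableSet {q : ℝ × ℝ × ℝ | 0 < q.2.1} :=
    measurableSet_lt measurable_const (measurable_fst.comp measurable_snd)
  have h3 : MeasurableSet {q : ℝ × ℝ × ℝ | 0 < q.2.2} :=
    measurableSet_lt measurable_const (measurable_snd.comp measurable_snd)
  have h4 : MeasurableSet {q : ℝ × ℝ × ℝ | 0 < lastGap q} :=
    measurableSet_lt measurable_const continuous_lastGap.measurable
  have h5 : MeasurableSet {q : ℝ × ℝ × ℝ | smallGap q / (Real.pi / 2) ∈ B} :=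
    (continuous_smallGap.div_const _).measurable hB
  exact h1.inter (h2.inter (h3.inter (h4.inter h5)))

theorem measurableSet_lowSet {B : Set ℝ} (hB : MeasurableSet B) : MeasurableSet (lowSet B) := by
  have hw := continuous_lastGap.measurable
  have h1 : MeasurableSet {q : ℝ × ℝ × ℝ | lastGap q < q.1} := measurableSet_lt hw measurable_fst
  have h2 : MeasurableSet {q : ℝ × ℝ × ℝ | lastGap q < q.2.1} :=
    measurableSet_lt hw (measurable_fst.comp measurable_snd)
  have h3 : MeasurableSet {q : ℝ × ℝ × ℝ | lastGap q < q.2.2} :=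
    measurableSet_lt hw (measurable_snd.comp measurable_snd)
  have h4 : MeasurableSet {q : ℝ × ℝ × ℝ | 0 < lastGap q} :=
    measurableSet_lt measurable_const hw
  have h5 : MeasurableSet {q : ℝ × ℝ × ℝ | lastGap q / (Real.pi / 2) ∈ B} :=
    (continuous_lastGap.div_const _).measurable hB
  exact h4.inter (h1.inter (h2.inter (h3.inter h5)))

/-- The density restricted to `gapSet`. -/
noncomputable def gapWeight (B : Set ℝ) : ℝ × ℝ × ℝ → ENNReal :=
  (gapSet B).indicator fun q => ENNReal.ofReal (gapDensity q)

/-- The density restricted to `lowSet`. -/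
noncomputable def lowWeight (B : Set ℝ) : ℝ × ℝ × ℝ → ENNReal :=
  (lowSet B).indicator fun q => ENNReal.ofReal (gapDensity q)

theorem measurable_gapWeight {B : Set ℝ} (hB : MeasurableSet B) : Measurable (gapWeight B) :=
  continuous_gapDensity.measurable.ennreal_ofReal.indicator (measurableSet_gapSet hB)

theorem measurable_lowWeight {B : Set ℝ} (hB : MeasurableSet B) : Measurable (lowWeight B) :=
  continuous_gapDensity.measurable.ennreal_ofReal.indicator (measurableSet_lowSet hB)

theorem indicator_strictBox_eq (B : Set ℝ) (a x y z : ℝ) :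
    (strictBox ∩ minGap ⁻¹' B).indicator (fun η => ENNReal.ofReal (vanderSq η))
      ![a, a + x, a + x + y, a + x + y + z] =
    (Set.Ico 0 (lastGap (x, y, z))).indicator (fun _ => gapWeight B (x, y, z)) a := by
  classical
  simp only [gapWeight, Set.indicator_apply, vanderSq_eq_gapDensity]
  rw [← ite_and]
  refine if_congr ?_ rfl rfl
  rw [Set.mem_inter_iff, mem_strictBox_iff, Set.mem_preimage, minGap_eq_smallGap, Set.mem_Ico]
  simp only [gapSet, Set.mem_ofPred_eq]
  constructor
  · rintro ⟨⟨⟨hx, hy, hz⟩, h0, ha⟩, hB⟩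
    exact ⟨⟨h0, ha⟩, hx, hy, hz, h0.trans_lt ha, hB⟩
  · rintro ⟨⟨h0, ha⟩, hx, hy, hz, _, hB⟩
    exact ⟨⟨⟨hx, hy, hz⟩, h0, ha⟩, hB⟩

theorem lintegral_strictBox {B : Set ℝ} (hB : MeasurableSet B) :
    ∫⁻ θ, (strictBox ∩ minGap ⁻¹' B).indicator (fun η => ENNReal.ofReal (vanderSq η)) θ =
      ∫⁻ q, ENNReal.ofReal (lastGap q) * gapWeight B q := by
  rw [lintegral_fin_four (measurable_indicator_strictBox hB)]
  set f := (strictBox ∩ minGap ⁻¹' B).indicator (fun η => ENNReal.ofReal (vanderSq η)) with hf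
  have h1 : ∀ a : ℝ, ∫⁻ (b : ℝ) (c : ℝ) (d : ℝ), f ![a, b, c, d] =
      ∫⁻ (x : ℝ) (y : ℝ) (z : ℝ), f ![a, a + x, a + x + y, a + x + y + z] := by
    intro a
    rw [← lintegral_add_left_eq_self _ a]
    refine lintegral_congr fun x => ?_
    rw [← lintegral_add_left_eq_self _ (a + x)]
    refine lintegral_congr fun y => ?_
    rw [← lintegral_add_left_eq_self _ (a + x + y)]
  rw [lintegral_congr h1]
  simp only [hf, indicator_strictBox_eq]
  have hmeas : Measurable fun p : ℝ × ℝ × ℝ × ℝ =>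
      (Set.Ico 0 (lastGap p.2)).indicator (fun _ => gapWeight B p.2) p.1 := by
    have hs : MeasurableSet {p : ℝ × ℝ × ℝ × ℝ | p.1 ∈ Set.Ico 0 (lastGap p.2)} :=
      (measurableSet_le measurable_const measurable_fst).inter
        (measurableSet_lt measurable_fst (continuous_lastGap.measurable.comp measurable_snd))
    exact ((measurable_gapWeight hB).comp measurable_snd).indicator hs
  have h2 : ∀ a : ℝ, ∫⁻ (x : ℝ) (y : ℝ) (z : ℝ),
      (Set.Ico 0 (lastGap (x, y, z))).indicator (fun _ => gapWeight B (x, y, z)) a =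
      ∫⁻ q, (Set.Ico 0 (lastGap q)).indicator (fun _ => gapWeight B q) a := by
    intro a
    rw [lintegral_triple]
    exact hmeas.comp (measurable_prodMk_left (x := a))
  rw [lintegral_congr h2, lintegral_lintegral_swap hmeas.aemeasurable]
  refine lintegral_congr fun q => ?_
  rw [lintegral_indicator_const measurableSet_Ico, Real.volume_Ico, sub_zero, mul_comm]

/-! ### Splitting according to the smallest gap -/

theorem exists_strict_min {x y z w : ℝ} (hxy : x ≠ y) (hxz : x ≠ z) (hyz : y ≠ z)
    (hx : w ≠ x) (hy : w ≠ y) (hz : w ≠ z) :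
    (w < x ∧ w < y ∧ w < z) ∨ (z < w ∧ z < x ∧ z < y) ∨ (y < z ∧ y < w ∧ y < x) ∨
      (x < y ∧ x < z ∧ x < w) := by
  grind

theorem gapWeight_eq_sum (B : Set ℝ) {x y z : ℝ} (hxy : x ≠ y) (hxz : x ≠ z) (hyz : y ≠ z)
    (hx : lastGap (x, y, z) ≠ x) (hy : lastGap (x, y, z) ≠ y) (hz : lastGap (x, y, z) ≠ z) :
    gapWeight B (x, y, z) = lowWeight B (x, y, z) + lowWeight B (rotGap (x, y, z)) +
      lowWeight B (rotGap (rotGap (x, y, z))) +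
      lowWeight B (rotGap (rotGap (rotGap (x, y, z)))) := by
  have hlow : ∀ q, q ∈ lowSet B ↔ 0 < lastGap q ∧ lastGap q < q.1 ∧ lastGap q < q.2.1 ∧
    lastGap q < q.2.2 ∧ lastGap q / (Real.pi / 2) ∈ B := fun _ => Iff.rfl
  have hrot : ∀ q, rotGap q ∈ lowSet B ↔ 0 < q.2.2 ∧ q.2.2 < lastGap q ∧ q.2.2 < q.1 ∧
      q.2.2 < q.2.1 ∧ q.2.2 / (Real.pi / 2) ∈ B := by
    intro q; rw [hlow, lastGap_rotGap]; rfl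
  have hgap : (x, y, z) ∈ gapSet B ↔ 0 < x ∧ 0 < y ∧ 0 < z ∧ 0 < lastGap (x, y, z) ∧
    min (min x y) (min z (lastGap (x, y, z))) / (Real.pi / 2) ∈ B := Iff.rfl
  have hw := hlow (x, y, z)
  have hz' := hrot (x, y, z)
  have e1 : ∀ q, (rotGap q).1 = lastGap q := fun _ => rfl
  have e2 : ∀ q, (rotGap q).2.1 = q.1 := fun _ => rfl
  have e3 : ∀ q, (rotGap q).2.2 = q.2.1 := fun _ => rfl
  have hy' := hrot (rotGap (x, y, z))
  have hx' := hrot (rotGap (rotGap (x, y, z)))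
  simp only [lastGap_rotGap, e1, e2, e3] at hy' hx' hz' hw
  have hind : ∀ p q, (p ∈ gapSet B ↔ q ∈ lowSet B) → gapDensity p = gapDensity q →
      gapWeight B p = lowWeight B q := by
    intro p q hpq hd
    classical
    simp only [gapWeight, lowWeight, Set.indicator_apply, hd, hpq]
  have hzero : ∀ q, q ∉ lowSet B → lowWeight B q = 0 := fun q hq => Set.indicator_of_notMem hq _
  generalize hwdef : lastGap (x, y, z) = w at *
  rcases exists_strict_min hxy hxz hyz hx hy hz with
    ⟨h1, h2, h3⟩ | ⟨h1, h2, h3⟩ | ⟨h1, h2, h3⟩ | ⟨h1, h2, h3⟩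
  · rw [min_eq_right h3.le, min_eq_right (le_min h1.le h2.le)] at hgap
    rw [hind (x, y, z) (x, y, z) ?_ rfl,
      hzero (rotGap (x, y, z)) (by rw [hz']; rintro ⟨_, _, _, _, _⟩; linarith),
      hzero (rotGap (rotGap (x, y, z))) (by rw [hy']; rintro ⟨_, _, _, _, _⟩; linarith),
      hzero (rotGap (rotGap (rotGap (x, y, z)))) (by rw [hx']; rintro ⟨_, _, _, _, _⟩; linarith)]
    · simp
    · rw [hgap, hw]
      exact ⟨fun ⟨_, _, _, _, h⟩ => ⟨by assumption, h1, h2, h3, h⟩,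
        fun ⟨_, _, _, _, h⟩ => ⟨by linarith, by linarith, by linarith, by linarith, h⟩⟩
  · rw [min_eq_left h1.le, min_eq_right (le_min h2.le h3.le)] at hgap
    rw [hind (x, y, z) (rotGap (x, y, z)) ?_ (by simp only [gapDensity_rotGap]),
      hzero (x, y, z) (by rw [hw]; rintro ⟨_, _, _, _, _⟩; linarith),
      hzero (rotGap (rotGap (x, y, z))) (by rw [hy']; rintro ⟨_, _, _, _, _⟩; linarith),
      hzero (rotGap (rotGap (rotGap (x, y, z)))) (by rw [hx']; rintro ⟨_, _, _, _, _⟩; linarith)]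
    · simp
    · rw [hgap, hz']
      exact ⟨fun ⟨_, _, _, _, h⟩ => ⟨by assumption, h1, h2, h3, h⟩,
        fun ⟨_, _, _, _, h⟩ => ⟨by linarith, by linarith, by linarith, by linarith, h⟩⟩
  · rw [min_eq_right h3.le, min_eq_left (le_min h1.le h2.le)] at hgap
    rw [hind (x, y, z) (rotGap (rotGap (x, y, z))) ?_ (by simp only [gapDensity_rotGap]),
      hzero (x, y, z) (by rw [hw]; rintro ⟨_, _, _, _, _⟩; linarith),
      hzero (rotGap (x, y, z)) (by rw [hz']; rintro ⟨_, _, _, _, _⟩; linarith),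
      hzero (rotGap (rotGap (rotGap (x, y, z)))) (by rw [hx']; rintro ⟨_, _, _, _, _⟩; linarith)]
    · simp
    · rw [hgap, hy']
      exact ⟨fun ⟨_, _, _, _, h⟩ => ⟨by assumption, h1, h2, h3, h⟩,
        fun ⟨_, _, _, _, h⟩ => ⟨by linarith, by linarith, by linarith, by linarith, h⟩⟩
  · rw [min_eq_left h1.le, min_eq_left (le_min h2.le h3.le)] at hgap
    rw [hind (x, y, z) (rotGap (rotGap (rotGap (x, y, z)))) ?_ (by simp only [gapDensity_rotGap]),
      hzero (x, y, z) (by rw [hw]; rintro ⟨_, _, _, _, _⟩; linarith),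
      hzero (rotGap (x, y, z)) (by rw [hz']; rintro ⟨_, _, _, _, _⟩; linarith),
      hzero (rotGap (rotGap (x, y, z))) (by rw [hy']; rintro ⟨_, _, _, _, _⟩; linarith)]
    · simp
    · rw [hgap, hx']
      exact ⟨fun ⟨_, _, _, _, h⟩ => ⟨by assumption, h1, h2, h3, h⟩,
        fun ⟨_, _, _, _, h⟩ => ⟨by linarith, by linarith, by linarith, by linarith, h⟩⟩

theorem lintegral_lastGap_mul_gapWeight {B : Set ℝ} (hB : MeasurableSet B) :
    ∫⁻ q, ENNReal.ofReal (lastGap q) * gapWeight B q =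
      ENNReal.ofReal (2 * Real.pi) * ∫⁻ q, lowWeight B q := by
  have hg := measurable_gapWeight hB
  have hl := measurable_lowWeight hB
  have hR := continuous_rotGap.measurable
  have hw := continuous_lastGap.measurable.ennreal_ofReal
  have m1 : Measurable fun q : ℝ × ℝ × ℝ => ENNReal.ofReal (lastGap q) * lowWeight B q := hw.mul hl
  have m2 : Measurable fun q : ℝ × ℝ × ℝ => ENNReal.ofReal q.1 * lowWeight B q :=
    measurable_fst.ennreal_ofReal.mul hl
  have m3 : Measurable fun q : ℝ × ℝ × ℝ => ENNReal.ofReal q.2.1 * lowWeight B q :=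
    (measurable_fst.comp measurable_snd).ennreal_ofReal.mul hl
  have m4 : Measurable fun q : ℝ × ℝ × ℝ => ENNReal.ofReal q.2.2 * lowWeight B q :=
    (measurable_snd.comp measurable_snd).ennreal_ofReal.mul hl
  have m2' : Measurable fun q => ENNReal.ofReal (rotGap q).1 * lowWeight B (rotGap q) :=
    m2.comp hR
  have m3' : Measurable fun q => ENNReal.ofReal (rotGap (rotGap q)).2.1 *
      lowWeight B (rotGap (rotGap q)) := (m3.comp hR).comp hR
  have m4' : Measurable fun q => ENNReal.ofReal (rotGap (rotGap (rotGap q))).2.2 *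
      lowWeight B (rotGap (rotGap (rotGap q))) := ((m4.comp hR).comp hR).comp hR
  have hsplit : ∫⁻ q, ENNReal.ofReal (lastGap q) * gapWeight B q =
      ∫⁻ q, (ENNReal.ofReal (lastGap q) * lowWeight B q +
        ENNReal.ofReal (rotGap q).1 * lowWeight B (rotGap q) +
        ENNReal.ofReal (rotGap (rotGap q)).2.1 * lowWeight B (rotGap (rotGap q)) +
        ENNReal.ofReal (rotGap (rotGap (rotGap q))).2.2 *
          lowWeight B (rotGap (rotGap (rotGap q)))) := by
    refine (lintegral_triple (hw.mul hg)).trans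
      (Eq.trans ?_ (lintegral_triple (((m1.add m2').add m3').add m4')).symm)
    refine lintegral_congr fun x => lintegral_congr_ae ?_
    filter_upwards [(Set.countable_singleton x).ae_notMem volume] with y hy
    refine lintegral_congr_ae ?_
    filter_upwards [(Set.toFinite ({x, y, 2 * Real.pi - 2 * x - y, 2 * Real.pi - x - 2 * y,
      (2 * Real.pi - x - y) / 2} : Set ℝ)).countable.ae_notMem volume] with z hz
    simp only [Set.mem_insert_iff, Set.mem_singleton_iff, not_or] at hy hz
    obtain ⟨h1, h2, h3, h4, h5⟩ := hz
    simp only [Pi.mul_apply, Pi.add_apply]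
    rw [gapWeight_eq_sum B (Ne.symm hy) (Ne.symm h1) (Ne.symm h2)
      (fun h => h3 (by simp only [lastGap] at h; linarith))
      (fun h => h4 (by simp only [lastGap] at h; linarith))
      (fun h => h5 (by simp only [lastGap] at h; linarith)), mul_add, mul_add, mul_add]
    rfl
  rw [hsplit, lintegral_add_right _ m4', lintegral_add_right _ m3', lintegral_add_right _ m2']
  have r2 := lintegral_comp_rotGap m2
  have r3 := (lintegral_comp_rotGap (m3.comp hR)).trans (lintegral_comp_rotGap m3)
  have r4 := ((lintegral_comp_rotGap ((m4.comp hR).comp hR)).trans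
    (lintegral_comp_rotGap (m4.comp hR))).trans (lintegral_comp_rotGap m4)
  simp only [Function.comp_apply] at r2 r3 r4
  rw [r2, r3, r4, ← lintegral_add_right _ m2, ← lintegral_add_right _ m3,
    ← lintegral_add_right _ m4, ← lintegral_const_mul _ hl]
  refine lintegral_congr fun q => ?_
  rw [← add_mul, ← add_mul, ← add_mul]
  by_cases hq : q ∈ lowSet B
  · obtain ⟨h0, h1, h2, h3, _⟩ := hq
    rw [← ENNReal.ofReal_add h0.le (by linarith), ← ENNReal.ofReal_add (by linarith) (by linarith),
      ← ENNReal.ofReal_add (by linarith) (by linarith)]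
    congr 2
    simp only [lastGap]; ring
  · rw [lowWeight, Set.indicator_of_notMem hq, mul_zero, mul_zero]

/-! ### The density as a double integral -/

/-- The pairs of gaps `(z, y)` such that the four gaps `(y, z, 2π - d - y - z, d)` have smallest
element `d`. -/
def pairSet (d : ℝ) : Set (ℝ × ℝ) :=
  {p | d < p.1 ∧ d < p.2 ∧ p.1 + p.2 < 2 * Real.pi - 2 * d}

/-- The density of the smallest gap, up to normalization. -/
noncomputable def gapKernel (d : ℝ) : ENNReal :=
  ∫⁻ (z : ℝ) (y : ℝ), (pairSet d).indicator
    (fun p => ENNReal.ofReal (gapDensity (p.2, p.1, 2 * Real.pi - d - p.2 - p.1))) (z, y)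

theorem lintegral_lowWeight {B : Set ℝ} (hB : MeasurableSet B) :
    ∫⁻ q, lowWeight B q =
      ∫⁻ d : ℝ, (Set.Ioi 0 ∩ {d | d / (Real.pi / 2) ∈ B}).indicator gapKernel d := by
  have hl := measurable_lowWeight hB
  have hR := continuous_rotGap.measurable
  have m3 : Measurable fun q => lowWeight B (rotGap (rotGap (rotGap q))) :=
    ((hl.comp hR).comp hR).comp hR
  have r := ((lintegral_comp_rotGap ((hl.comp hR).comp hR)).trans
    (lintegral_comp_rotGap (hl.comp hR))).trans (lintegral_comp_rotGap hl)
  simp only [Function.comp_apply] at r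
  rw [← r, lintegral_triple m3]
  refine lintegral_congr fun d => ?_
  have hrot3 : ∀ y z : ℝ, rotGap (rotGap (rotGap (d, y, z))) =
      (y, z, 2 * Real.pi - d - y - z) := by
    intro y z
    simp only [rotGap, lastGap]
    ring_nf
  have hval : ∀ y z : ℝ, lowWeight B (rotGap (rotGap (rotGap (d, y, z)))) =
      (Set.Ioi 0 ∩ {d | d / (Real.pi / 2) ∈ B}).indicator (fun d => (pairSet d).indicator
      (fun p => ENNReal.ofReal (gapDensity (p.2, p.1, 2 * Real.pi - d - p.2 - p.1))) (z, y)) d := by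
    intro y z
    classical
    rw [hrot3]
    simp only [lowWeight, Set.indicator_apply]
    rw [← ite_and]
    refine if_congr ?_ rfl rfl
    have hlg : lastGap (y, z, 2 * Real.pi - d - y - z) = d := by simp only [lastGap]; ring
    simp only [lowSet, pairSet, Set.mem_ofPred_eq, hlg, Set.mem_inter_iff, Set.mem_Ioi]
    constructor
    · rintro ⟨h1, h2, h3, h4, h5⟩
      exact ⟨⟨h1, h5⟩, h3, h2, by linarith⟩
    · rintro ⟨⟨h1, h5⟩, h3, h2, h4⟩
      exact ⟨h1, h2, h3, by linarith, h5⟩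
  rw [lintegral_lintegral_swap
    (f := fun y z => lowWeight B (rotGap (rotGap (rotGap (d, y, z)))))
    (m3.comp (measurable_prodMk_left (x := d))).aemeasurable]
  simp only [hval]
  by_cases hd : d ∈ Set.Ioi 0 ∩ {d | d / (Real.pi / 2) ∈ B}
  · simp only [Set.indicator_of_mem hd, gapKernel]
  · simp only [Set.indicator_of_notMem hd, lintegral_zero]

theorem map_sMin_eq_lintegral_gapKernel {B : Set ℝ} (hB : MeasurableSet B) :
    (cue 4).map (fun U : Matrix.unitaryGroup (Fin 4) ℂ => sMin U.1) B =
      ENNReal.ofReal (1 / (2 * Real.pi) ^ 3) *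
        ∫⁻ d : ℝ, (Set.Ioi 0 ∩ {d | d / (Real.pi / 2) ∈ B}).indicator gapKernel d := by
  rw [map_sMin_eq_lintegral hB, lintegral_strictBox hB, lintegral_lastGap_mul_gapWeight hB,
    lintegral_lowWeight hB, ← mul_assoc, ← ENNReal.ofReal_mul (by positivity)]
  congr 2
  have := Real.pi_ne_zero
  field_simp

/-! ### The explicit form of the kernel -/

/-- The square root of the density of the position of a spacing, up to a constant. -/
noncomputable def pairFactor (c p m : ℝ) : ℝ :=
  Real.cos m ^ 2 + 2 * c * p * Real.cos m + (c ^ 2 + p ^ 2 - 1)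

/-- The odd primitive of `pairFactor ^ 2`, as a polynomial in `m`, `S = sin m` and `C = cos m`. -/
noncomputable def pairPoly (c p m S C : ℝ) : ℝ :=
  3 / 8 * m + 3 / 8 * (S * C) + 1 / 4 * (S * C ^ 3) + 4 * c * p * (S - 1 / 3 * S ^ 3)
    + 1 / 2 * (4 * c ^ 2 * p ^ 2 + 2 * (c ^ 2 + p ^ 2 - 1)) * (m + S * C)
    + 4 * c * p * (c ^ 2 + p ^ 2 - 1) * S + (c ^ 2 + p ^ 2 - 1) ^ 2 * m

theorem pairPoly_neg (c p m S C : ℝ) : pairPoly c p (-m) (-S) C = -pairPoly c p m S C := by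
  unfold pairPoly; ring

theorem hasDerivAt_pairPoly (c p m : ℝ) :
    HasDerivAt (fun m => pairPoly c p m (Real.sin m) (Real.cos m)) (pairFactor c p m ^ 2) m := by
  unfold pairPoly pairFactor
  have hm := hasDerivAt_id' m
  have hS := Real.hasDerivAt_sin m
  have hC := Real.hasDerivAt_cos m
  apply HasDerivAt.congr_deriv
  · repeat' first
      | exact hm | exact hS | exact hC
      | apply HasDerivAt.fun_sub | apply HasDerivAt.fun_add | apply HasDerivAt.const_mul
      | apply HasDerivAt.mul_const | apply HasDerivAt.fun_pow | apply HasDerivAt.fun_mul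
  · have h := Real.sin_sq_add_cos_sq m
    simp only [Nat.cast_ofNat, Nat.add_one_sub_one, mul_one]
    linear_combination (-3 / 8 - 3 / 4 * Real.cos m ^ 2 - 4 * c * p * Real.cos m
      - 1 / 2 * (4 * c ^ 2 * p ^ 2 + 2 * (c ^ 2 + p ^ 2 - 1))) * h

theorem chord_mul_chord_add (y d : ℝ) :
    chord y * chord (y + d) = 4 * (Real.cos (d / 2) - Real.cos (y + d / 2)) ^ 2 := by
  have h1 : Real.cos y = Real.cos (y + d / 2) * Real.cos (d / 2)
      + Real.sin (y + d / 2) * Real.sin (d / 2) := by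
    rw [← Real.cos_sub]; ring_nf
  have h2 : Real.cos (y + d) = Real.cos (y + d / 2) * Real.cos (d / 2)
      - Real.sin (y + d / 2) * Real.sin (d / 2) := by
    rw [← Real.cos_add]; ring_nf
  rw [chord, chord, h1, h2]
  linear_combination -4 * Real.sin (d / 2) ^ 2 * Real.sin_sq_add_cos_sq (y + d / 2)
    + (4 * Real.cos (y + d / 2) ^ 2 - 4) * Real.sin_sq_add_cos_sq (d / 2)

theorem gapDensity_eq_pairFactor_sq (d z y : ℝ) :
    gapDensity (y, z, 2 * Real.pi - d - y - z) = 16 * chord d * chord z *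
      pairFactor (Real.cos (d / 2)) (Real.cos (z / 2)) (y - Real.pi + d / 2 + z / 2) ^ 2 := by
  set m := y - Real.pi + d / 2 + z / 2 with hm
  have e1 : chord (2 * Real.pi - d - y - z) = chord (y + z + d) := by
    rw [← chord_two_pi_sub]; ring_nf
  have e2 : chord (z + (2 * Real.pi - d - y - z)) = chord (y + d) := by
    rw [← chord_two_pi_sub]; ring_nf
  have e3 : chord (y + z + (2 * Real.pi - d - y - z)) = chord d := by
    rw [← chord_two_pi_sub]; ring_nf
  have f1 : Real.cos (y + d / 2) = -(Real.cos m * Real.cos (z / 2) + Real.sin m * Real.sin (z / 2)) := by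
    rw [← Real.cos_sub, ← Real.cos_add_pi, hm]; ring_nf
  have f2 : Real.cos (y + z + d / 2) =
      -(Real.cos m * Real.cos (z / 2) - Real.sin m * Real.sin (z / 2)) := by
    rw [← Real.cos_add, ← Real.cos_add_pi, hm]; ring_nf
  have hQ : pairFactor (Real.cos (d / 2)) (Real.cos (z / 2)) m =
      (Real.cos (d / 2) - Real.cos (y + d / 2)) * (Real.cos (d / 2) - Real.cos (y + z + d / 2)) := by
    rw [f1, f2, pairFactor]
    linear_combination (Real.sin (z / 2) ^ 2) * Real.sin_sq_add_cos_sq m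
      + (1 - Real.cos m ^ 2) * Real.sin_sq_add_cos_sq (z / 2)
  simp only [gapDensity, e1, e2, e3, hQ]
  linear_combination chord d * chord z * chord (y + z) * chord (y + z + d) * chord_mul_chord_add y d
    + 4 * chord d * chord z * (Real.cos (d / 2) - Real.cos (y + d / 2)) ^ 2
      * chord_mul_chord_add (y + z) d

/-- A primitive of `m ↦ (1 - p ^ 2) * pairPoly c p m S C` for `S = sin m`, `C = cos m`,
`p = cos (a - m)` and `q = sin (a - m)`. -/
noncomputable def kernelPoly (c m p q S C : ℝ) : ℝ :=
  (1 / 16 * m ^ 2 + 1 / 6 * m * p ^ 5 * q - 7 / 24 * m * p ^ 3 * q + 1 / 4 * m * p ^ 2 * S * C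
    + 1 / 4 * m * p * q * C ^ 2 + 1 / 8 * m * p * q - 1 / 8 * m * S * C - 1 / 36 * p ^ 6
    - 1 / 6 * p ^ 4 * C ^ 2 + 5 / 32 * p ^ 4 + 1 / 3 * p ^ 3 * q * S * C + 1 / 12 * p ^ 2 * C ^ 4
    + 1 / 48 * p ^ 2 * C ^ 2 - 1 / 6 * p ^ 2 - 1 / 24 * p * q * S * C ^ 3
    - 5 / 24 * p * q * S * C - 7 / 96 * C ^ 4 + 7 / 48 * C ^ 2)
  + c * (-2 / 3 * m * p ^ 3 * S * C ^ 2 + 1 / 6 * m * p ^ 3 * S - 2 / 3 * m * p ^ 2 * q * C ^ 3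
    + 1 / 2 * m * p ^ 2 * q * C + 1 / 2 * m * p * S * C ^ 2 + 1 / 6 * m * q * C ^ 3
    - 1 / 6 * p ^ 5 * C + 5 / 6 * p ^ 4 * q * S + 1 / 9 * p ^ 3 * C ^ 3 + 1 / 8 * p ^ 3 * C
    + 1 / 9 * p ^ 2 * q * S * C ^ 2 - 47 / 72 * p ^ 2 * q * S - 5 / 24 * p * C ^ 3
    + 1 / 24 * p * C + 1 / 72 * q * S * C ^ 2 - 1 / 72 * q * S)
  + c ^ 2 * (m * p ^ 3 * q - 1 / 2 * m * p ^ 2 * S * C - 1 / 2 * m * p * q * C ^ 2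
    - 3 / 4 * m * p * q + 1 / 4 * m * S * C - 1 / 3 * p ^ 4 * C ^ 2 - 1 / 12 * p ^ 4
    + 2 / 3 * p ^ 3 * q * S * C + 11 / 24 * p ^ 2 * C ^ 2 + 13 / 48 * p ^ 2
    - 5 / 24 * p * q * S * C - 23 / 48 * C ^ 2)
  + c ^ 3 * (1 / 2 * m * p * S + 1 / 2 * m * q * C - 1 / 2 * p ^ 3 * C + 3 / 2 * p ^ 2 * q * S
    + 1 / 8 * p * C - 5 / 8 * q * S)
  + c ^ 4 * (1 / 4 * m ^ 2 + 1 / 2 * m * p * q - 1 / 4 * p ^ 2)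

theorem hasDerivAt_kernelPoly {m p q S C : ℝ → ℝ} {c k x : ℝ}
    (hm : HasDerivAt m k x) (hp : HasDerivAt p (k * q x) x) (hq : HasDerivAt q (-(k * p x)) x)
    (hS : HasDerivAt S (k * C x) x) (hC : HasDerivAt C (-(k * S x)) x)
    (hpq : q x ^ 2 + p x ^ 2 = 1) (hSC : S x ^ 2 + C x ^ 2 = 1) :
    HasDerivAt (fun x => kernelPoly c (m x) (p x) (q x) (S x) (C x))
      (k * ((1 - p x ^ 2) * pairPoly c (p x) (m x) (S x) (C x))) x := by
  unfold kernelPoly pairPoly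
  apply HasDerivAt.congr_deriv
  · repeat' first
      | exact hm | exact hp | exact hq | exact hS | exact hC
      | apply HasDerivAt.fun_sub | apply HasDerivAt.fun_add | apply HasDerivAt.const_mul
      | apply HasDerivAt.fun_pow | apply HasDerivAt.fun_mul
  · clear hm hp hq hS hC
    generalize m x = m, p x = p, q x = q, S x = S, C x = C at *
    simp only [Nat.cast_ofNat, Nat.add_one_sub_one]
    linear_combination k * ((5 / 6 * m * p ^ 4 - 7 / 8 * m * p ^ 2 + 1 / 4 * m * C ^ 2 + 1 / 8 * m
        + p ^ 2 * S * C - 1 / 24 * S * C ^ 3 - 5 / 24 * S * C)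
      + c * (-4 / 3 * m * p * C ^ 3 + m * p * C + 10 / 3 * p ^ 3 * S + 2 / 9 * p * S * C ^ 2
        - 47 / 36 * p * S)
      + c ^ 2 * (3 * m * p ^ 2 - 1 / 2 * m * C ^ 2 - 3 / 4 * m + 2 * p ^ 2 * S * C
        - 5 / 24 * S * C)
      + c ^ 3 * (3 * p * S) + c ^ 4 * (1 / 2 * m)) * hpq
      + k * ((-1 / 4 * m * p ^ 2 + 1 / 8 * m - 1 / 3 * p ^ 3 * q + 1 / 8 * p * q * C ^ 2
        + 5 / 24 * p * q)
      + c * (4 / 3 * m * p ^ 3 * C - m * p * C - 4 / 3 * p ^ 3 * S - 2 / 9 * p ^ 2 * q * C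
        + 4 / 3 * p * S - 1 / 36 * q * C)
      + c ^ 2 * (1 / 2 * m * p ^ 2 - 1 / 4 * m - 2 / 3 * p ^ 3 * q + 5 / 24 * p * q)) * hSC

theorem densityCUE4_eq_kernelPoly (s τ : ℝ) (hτ : Real.pi * s / 4 = τ) :
    densityCUE4 s = 64 / Real.pi ^ 2 * Real.sin τ ^ 2 *
      (kernelPoly (Real.cos τ) (Real.pi - 4 * τ) (Real.cos τ) (Real.sin τ)
          (Real.sin (4 * τ)) (-Real.cos (4 * τ))
        - kernelPoly (Real.cos τ) 0 (-Real.cos (3 * τ)) (Real.sin (3 * τ)) 0 1) := by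
  have hL : Real.pi * (1 - s) = Real.pi - 4 * τ := by rw [← hτ]; ring
  have crec : ∀ a b e : ℝ, a = b + 2 * τ → e = b - 2 * τ →
      Real.cos a = 2 * Real.cos (2 * τ) * Real.cos b - Real.cos e := by
    rintro a b e rfl rfl
    rw [Real.cos_add, Real.cos_sub]; ring
  have srec : ∀ a b e : ℝ, a = b + 2 * τ → e = b - 2 * τ →
      Real.sin a = 2 * Real.cos (2 * τ) * Real.sin b - Real.sin e := by
    rintro a b e rfl rfl
    rw [Real.sin_add, Real.sin_sub]; ring
  have c2 : Real.cos (2 * τ) = 2 * Real.cos τ ^ 2 - 1 := Real.cos_two_mul τ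
  have s2 : Real.sin (2 * τ) = 2 * Real.sin τ * Real.cos τ := Real.sin_two_mul τ
  have c4 := crec (4 * τ) (2 * τ) 0 (by ring) (by ring)
  have c6 := crec (6 * τ) (4 * τ) (2 * τ) (by ring) (by ring)
  have c8 := crec (8 * τ) (6 * τ) (4 * τ) (by ring) (by ring)
  have c10 := crec (10 * τ) (8 * τ) (6 * τ) (by ring) (by ring)
  have c12 := crec (12 * τ) (10 * τ) (8 * τ) (by ring) (by ring)
  have c14 := crec (14 * τ) (12 * τ) (10 * τ) (by ring) (by ring)
  have c16 := crec (16 * τ) (14 * τ) (12 * τ) (by ring) (by ring)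
  have c18 := crec (18 * τ) (16 * τ) (14 * τ) (by ring) (by ring)
  have s4 := srec (4 * τ) (2 * τ) 0 (by ring) (by ring)
  have s6 := srec (6 * τ) (4 * τ) (2 * τ) (by ring) (by ring)
  have s8 := srec (8 * τ) (6 * τ) (4 * τ) (by ring) (by ring)
  have s10 := srec (10 * τ) (8 * τ) (6 * τ) (by ring) (by ring)
  rw [Real.cos_zero, c2] at c4
  rw [Real.sin_zero, c2, s2] at s4
  rw [c4, c2] at c6
  rw [c6, c4, c2] at c8
  rw [c8, c6, c2] at c10
  rw [c10, c8, c2] at c12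
  rw [c12, c10, c2] at c14
  rw [c14, c12, c2] at c16
  rw [c16, c14, c2] at c18
  rw [s4, s2, c2] at s6
  rw [s6, s4, c2] at s8
  rw [s8, s6, c2] at s10
  have e4 : Real.pi * s = 4 * τ := by rw [← hτ]; ring
  have e2 : Real.pi * s / 2 = 2 * τ := by linarith
  have e6 : 3 * Real.pi * s / 2 = 6 * τ := by linarith
  have e8 : 2 * Real.pi * s = 8 * τ := by linarith
  have e10 : 5 * Real.pi * s / 2 = 10 * τ := by linarith
  have e12 : 3 * Real.pi * s = 12 * τ := by linarith
  have e14 : 7 * Real.pi * s / 2 = 14 * τ := by linarith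
  have e16 : 4 * Real.pi * s = 16 * τ := by linarith
  have e18 : 9 * Real.pi * s / 2 = 18 * τ := by linarith
  have h := Real.sin_sq_add_cos_sq τ
  have key : 666 + 720 * Real.pi ^ 2 * (1 - s) ^ 2
      + 36 * (11 + 16 * Real.pi ^ 2 * (1 - s) ^ 2) * Real.cos (2 * τ)
      + 18 * (8 * Real.pi ^ 2 * (1 - s) ^ 2 - 13) * Real.cos (4 * τ)
      - 100 * Real.cos (6 * τ) - 608 * Real.cos (8 * τ)
      - 380 * Real.cos (10 * τ) + 234 * Real.cos (12 * τ)
      + 74 * Real.cos (14 * τ) - 58 * Real.cos (16 * τ) + 10 * Real.cos (18 * τ)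
      + 24 * Real.pi * (1 - s) *
        (60 * Real.sin (2 * τ) + 63 * Real.sin (4 * τ) + 22 * Real.sin (6 * τ)
          + 2 * Real.sin (8 * τ) - 4 * Real.sin (10 * τ)) =
      4608 * (kernelPoly (Real.cos τ) (Real.pi - 4 * τ) (Real.cos τ) (Real.sin τ)
          (Real.sin (4 * τ)) (-Real.cos (4 * τ))
        - kernelPoly (Real.cos τ) 0 (-Real.cos (3 * τ)) (Real.sin (3 * τ)) 0 1) := by
    rw [← hL, c18, c16, c14, c12, c10, c8, c6, c4, c2, s10, s8, s6, s4, s2, Real.cos_three_mul,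
      Real.sin_three_mul]
    unfold kernelPoly
    generalize Real.cos τ = c, Real.sin τ = r at h ⊢
    linear_combination (-786432 * c ^ 16 + 2490368 * c ^ 14 - 3014656 * c ^ 12 + 1937408 * c ^ 10
      - 944128 * c ^ 8 + 387584 * c ^ 6 - 86272 * c ^ 4 + 4608 * c ^ 2) * h
  rw [densityCUE4, e18, e16, e14, e6, e12, e10, e8, e2, hτ, e4, key]
  field_simp
  ring

theorem pairPoly_nonneg (c p : ℝ) {m : ℝ} (hm : 0 ≤ m) :
    0 ≤ pairPoly c p m (Real.sin m) (Real.cos m) := by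
  have hmono : Monotone fun m => pairPoly c p m (Real.sin m) (Real.cos m) :=
    monotone_of_deriv_nonneg (fun x => (hasDerivAt_pairPoly c p x).differentiableAt)
      fun x => by rw [(hasDerivAt_pairPoly c p x).deriv]; positivity
  have h := hmono hm
  have h0 : pairPoly c p 0 (Real.sin 0) (Real.cos 0) = 0 := by
    simp [pairPoly]
  simpa only [h0] using h

theorem chord_nonneg (t : ℝ) : 0 ≤ chord t := by
  have := Real.cos_le_one t
  unfold chord; linarith

theorem chord_eq_sin_sq (t : ℝ) : chord t = 4 * Real.sin (t / 2) ^ 2 := by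
  rw [chord, Real.sin_sq, Real.cos_sq]; ring_nf

theorem integral_gapDensity (d z : ℝ) :
    ∫ y in d..(2 * Real.pi - 2 * d - z), gapDensity (y, z, 2 * Real.pi - d - y - z) =
      32 * chord d * chord z * pairPoly (Real.cos (d / 2)) (Real.cos (z / 2))
        (Real.pi - 3 * d / 2 - z / 2) (Real.sin (Real.pi - 3 * d / 2 - z / 2))
        (Real.cos (Real.pi - 3 * d / 2 - z / 2)) := by
  have hder : ∀ y : ℝ, HasDerivAt (fun y => 16 * chord d * chord z *
      (fun m => pairPoly (Real.cos (d / 2)) (Real.cos (z / 2)) m (Real.sin m) (Real.cos m))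
        (y - Real.pi + d / 2 + z / 2)) (gapDensity (y, z, 2 * Real.pi - d - y - z)) y := by
    intro y
    rw [gapDensity_eq_pairFactor_sq]
    have h1 : HasDerivAt (fun y : ℝ => y - Real.pi + d / 2 + z / 2) 1 y :=
      (((hasDerivAt_id' y).sub_const _).add_const _).add_const _
    have h2 := ((hasDerivAt_pairPoly (Real.cos (d / 2)) (Real.cos (z / 2))
      (y - Real.pi + d / 2 + z / 2)).comp y h1).const_mul (16 * chord d * chord z)
    exact h2.congr_deriv (by rw [mul_one])
  have hcont : Continuous fun y => gapDensity (y, z, 2 * Real.pi - d - y - z) :=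
    continuous_gapDensity.comp (by fun_prop)
  rw [intervalIntegral.integral_eq_sub_of_hasDerivAt (fun y _ => hder y)
    (hcont.intervalIntegrable _ _)]
  have e1 : 2 * Real.pi - 2 * d - z - Real.pi + d / 2 + z / 2 =
      Real.pi - 3 * d / 2 - z / 2 := by ring
  have e2 : d - Real.pi + d / 2 + z / 2 = -(Real.pi - 3 * d / 2 - z / 2) := by ring
  simp only [e1, e2, Real.sin_neg, Real.cos_neg, pairPoly_neg]
  ring

/-- The density of the smallest gap, up to normalization, in closed form. -/
noncomputable def kernelValue (d : ℝ) : ℝ :=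
  1024 * Real.sin (d / 2) ^ 2 *
    (kernelPoly (Real.cos (d / 2)) (Real.pi - 4 * (d / 2)) (Real.cos (d / 2)) (Real.sin (d / 2))
        (Real.sin (4 * (d / 2))) (-Real.cos (4 * (d / 2)))
      - kernelPoly (Real.cos (d / 2)) 0 (-Real.cos (3 * (d / 2))) (Real.sin (3 * (d / 2))) 0 1)

theorem integral_chord_mul_pairPoly (d : ℝ) :
    ∫ z in d..(2 * Real.pi - 3 * d), 32 * chord d * chord z *
      pairPoly (Real.cos (d / 2)) (Real.cos (z / 2))
        (Real.pi - 3 * d / 2 - z / 2) (Real.sin (Real.pi - 3 * d / 2 - z / 2))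
        (Real.cos (Real.pi - 3 * d / 2 - z / 2)) = kernelValue d := by
  have hder : ∀ z : ℝ, HasDerivAt (fun z => -(1024 * Real.sin (d / 2) ^ 2) *
      kernelPoly (Real.cos (d / 2)) (Real.pi - 3 * d / 2 - z / 2) (Real.cos (z / 2))
        (Real.sin (z / 2)) (Real.sin (Real.pi - 3 * d / 2 - z / 2))
        (Real.cos (Real.pi - 3 * d / 2 - z / 2)))
      (32 * chord d * chord z *
      pairPoly (Real.cos (d / 2)) (Real.cos (z / 2))
        (Real.pi - 3 * d / 2 - z / 2) (Real.sin (Real.pi - 3 * d / 2 - z / 2))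
        (Real.cos (Real.pi - 3 * d / 2 - z / 2))) z := by
    intro z
    have h0 : HasDerivAt (fun z : ℝ => z / 2) (1 / 2) z := (hasDerivAt_id' z).div_const 2
    have hm : HasDerivAt (fun z : ℝ => Real.pi - 3 * d / 2 - z / 2) (-1 / 2) z := by
      exact (h0.const_sub (Real.pi - 3 * d / 2)).congr_deriv (by norm_num)
    have hp : HasDerivAt (fun z : ℝ => Real.cos (z / 2)) (-1 / 2 * Real.sin (z / 2)) z := by
      exact h0.cos.congr_deriv (by ring)
    have hq : HasDerivAt (fun z : ℝ => Real.sin (z / 2)) (-(-1 / 2 * Real.cos (z / 2))) z := by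
      exact h0.sin.congr_deriv (by ring)
    have hS : HasDerivAt (fun z : ℝ => Real.sin (Real.pi - 3 * d / 2 - z / 2))
        (-1 / 2 * Real.cos (Real.pi - 3 * d / 2 - z / 2)) z := by
      exact hm.sin.congr_deriv (by ring)
    have hC : HasDerivAt (fun z : ℝ => Real.cos (Real.pi - 3 * d / 2 - z / 2))
        (-(-1 / 2 * Real.sin (Real.pi - 3 * d / 2 - z / 2))) z := by
      exact hm.cos.congr_deriv (by ring)
    refine ((hasDerivAt_kernelPoly (c := Real.cos (d / 2))
      (p := fun z => Real.cos (z / 2)) (q := fun z => Real.sin (z / 2))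
      (S := fun z => Real.sin (Real.pi - 3 * d / 2 - z / 2))
      (C := fun z => Real.cos (Real.pi - 3 * d / 2 - z / 2)) hm hp hq hS hC
      (Real.sin_sq_add_cos_sq _) (Real.sin_sq_add_cos_sq _)).const_mul
      (-(1024 * Real.sin (d / 2) ^ 2))).congr_deriv ?_
    rw [chord_eq_sin_sq d, chord_eq_sin_sq z, Real.sin_sq (z / 2)]
    ring
  have hcont : Continuous fun z => 32 * chord d * chord z *
      pairPoly (Real.cos (d / 2)) (Real.cos (z / 2))
        (Real.pi - 3 * d / 2 - z / 2) (Real.sin (Real.pi - 3 * d / 2 - z / 2))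
        (Real.cos (Real.pi - 3 * d / 2 - z / 2)) := by
    unfold chord pairPoly
    fun_prop
  rw [intervalIntegral.integral_eq_sub_of_hasDerivAt (fun y _ => hder y)
    (hcont.intervalIntegrable _ _), kernelValue]
  have e1 : (2 * Real.pi - 3 * d) / 2 = Real.pi - 3 * (d / 2) := by ring
  have e2 : Real.pi - 3 * d / 2 - (Real.pi - 3 * (d / 2)) = 0 := by ring
  have e3 : Real.pi - 3 * d / 2 - d / 2 = Real.pi - 4 * (d / 2) := by ring
  rw [e1, e2, e3, Real.cos_pi_sub, Real.sin_pi_sub, Real.cos_pi_sub, Real.sin_pi_sub,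
    Real.sin_zero, Real.cos_zero]
  ring

theorem lintegral_Ioo_ofReal {f : ℝ → ℝ} (hf : Continuous f) {a b : ℝ} (hab : a ≤ b)
    (h0 : ∀ x ∈ Set.Ioo a b, 0 ≤ f x) :
    ∫⁻ x in Set.Ioo a b, ENNReal.ofReal (f x) = ENNReal.ofReal (∫ x in a..b, f x) := by
  rw [intervalIntegral.integral_of_le hab, integral_Ioc_eq_integral_Ioo,
    ofReal_integral_eq_lintegral_ofReal]
  · exact (hf.integrableOn_Icc).mono_set Set.Ioo_subset_Icc_self
  · exact (ae_restrict_iff' measurableSet_Ioo).2 (Filter.Eventually.of_forall h0)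

theorem gapKernel_eq_ofReal_kernelValue {d : ℝ} (hd : d ≤ Real.pi / 2) :
    gapKernel d = ENNReal.ofReal (kernelValue d) := by
  have inner : ∀ z : ℝ, ∫⁻ y : ℝ, (pairSet d).indicator
      (fun p => ENNReal.ofReal (gapDensity (p.2, p.1, 2 * Real.pi - d - p.2 - p.1))) (z, y) =
      (Set.Ioo d (2 * Real.pi - 3 * d)).indicator (fun z => ENNReal.ofReal (32 * chord d * chord z *
      pairPoly (Real.cos (d / 2)) (Real.cos (z / 2))
        (Real.pi - 3 * d / 2 - z / 2) (Real.sin (Real.pi - 3 * d / 2 - z / 2))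
        (Real.cos (Real.pi - 3 * d / 2 - z / 2)))) z := by
    intro z
    by_cases hz : z ∈ Set.Ioo d (2 * Real.pi - 3 * d)
    · have hcont : Continuous fun y => gapDensity (y, z, 2 * Real.pi - d - y - z) :=
        continuous_gapDensity.comp (by fun_prop)
      rw [Set.indicator_of_mem hz, ← integral_gapDensity, ← lintegral_Ioo_ofReal hcont
        (by linarith [hz.2])
        (fun y _ => by
          rw [gapDensity_eq_pairFactor_sq]
          have := chord_nonneg d
          have := chord_nonneg z
          positivity), ← lintegral_indicator measurableSet_Ioo]
      refine lintegral_congr fun y => ?_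
      by_cases hy : y ∈ Set.Ioo d (2 * Real.pi - 2 * d - z)
      · rw [Set.indicator_of_mem hy, Set.indicator_of_mem]
        exact ⟨hz.1, hy.1, by simp only; linarith [hy.2]⟩
      · rw [Set.indicator_of_notMem hy, Set.indicator_of_notMem]
        rintro ⟨-, h2, h3⟩
        exact hy ⟨h2, by simp only at h3; linarith⟩
    · rw [Set.indicator_of_notMem hz]
      refine (lintegral_congr fun y => Set.indicator_of_notMem ?_ _).trans lintegral_zero
      rintro ⟨h1, h2, h3⟩
      exact hz ⟨h1, by simp only at h2 h3; linarith⟩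
  rw [gapKernel, lintegral_congr inner, lintegral_indicator measurableSet_Ioo,
    lintegral_Ioo_ofReal _ (by linarith), integral_chord_mul_pairPoly]
  · intro z hz
    exact mul_nonneg (mul_nonneg (mul_nonneg (by norm_num) (chord_nonneg d)) (chord_nonneg z))
      (pairPoly_nonneg _ _ (by linarith [hz.2]))
  · unfold chord pairPoly
    fun_prop

theorem kernelValue_nonneg {d : ℝ} (hd : d ≤ Real.pi / 2) : 0 ≤ kernelValue d := by
  rw [← integral_chord_mul_pairPoly]
  refine intervalIntegral.integral_nonneg (by linarith) fun z hz => ?_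
  exact mul_nonneg (mul_nonneg (mul_nonneg (by norm_num) (chord_nonneg d)) (chord_nonneg z))
    (pairPoly_nonneg _ _ (by linarith [hz.2]))

theorem gapKernel_eq_zero {d : ℝ} (hd : Real.pi / 2 ≤ d) : gapKernel d = 0 := by
  have h : ∀ z y : ℝ, (pairSet d).indicator (fun p => ENNReal.ofReal
      (gapDensity (p.2, p.1, 2 * Real.pi - d - p.2 - p.1))) (z, y) = 0 := by
    intro z y
    refine Set.indicator_of_notMem ?_ _
    rintro ⟨h1, h2, h3⟩
    simp only at h1 h2 h3
    linarith
  simp only [gapKernel, h, lintegral_zero]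

theorem kernelValue_pi_div_two_mul (s : ℝ) :
    kernelValue (Real.pi / 2 * s) = 16 * Real.pi ^ 2 * densityCUE4 s := by
  rw [densityCUE4_eq_kernelPoly s (Real.pi / 2 * s / 2) (by ring), kernelValue]
  have := Real.pi_ne_zero
  field_simp
  ring

theorem densityCUE4_nonneg {s : ℝ} (hs : s ≤ 1) : 0 ≤ densityCUE4 s := by
  have h := kernelValue_nonneg (d := Real.pi / 2 * s) (by nlinarith [Real.pi_pos])
  rw [kernelValue_pi_div_two_mul] at h
  exact nonneg_of_mul_nonneg_right h (by positivity)

theorem densityCUE4_zero : densityCUE4 0 = 0 := by simp [densityCUE4]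

theorem densityCUE4_one : densityCUE4 1 = 0 := by
  have h : kernelValue (Real.pi / 2) = 0 := by
    rw [← integral_chord_mul_pairPoly, show 2 * Real.pi - 3 * (Real.pi / 2) = Real.pi / 2 by ring,
      intervalIntegral.integral_same]
  have h' := kernelValue_pi_div_two_mul 1
  rw [mul_one, h] at h'
  have := Real.pi_pos
  exact (mul_eq_zero.1 h'.symm).resolve_left (by positivity)

theorem continuous_densityCUE4 : Continuous densityCUE4 := by
  unfold densityCUE4
  fun_prop

/-! ### The law of the minimal spacing -/

theorem lintegral_eq_lintegral_comp_mul_left (f : ℝ → ENNReal) {a : ℝ} (ha : 0 < a) :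
    ∫⁻ x, f x = ENNReal.ofReal a * ∫⁻ x, f (a * x) := by
  have h1 : ∫⁻ x, f (a * x) =
      ∫⁻ x, f x ∂(volume.map (Homeomorph.mulLeft₀ a ha.ne').toMeasurableEquiv) :=
    (lintegral_map_equiv f (Homeomorph.mulLeft₀ a ha.ne').toMeasurableEquiv).symm
  have h2 : (volume : Measure ℝ).map (Homeomorph.mulLeft₀ a ha.ne').toMeasurableEquiv =
      ENNReal.ofReal |a⁻¹| • volume := Real.map_volume_mul_left ha.ne'
  rw [h1, h2, lintegral_smul_measure, smul_eq_mul, ← mul_assoc, ← ENNReal.ofReal_mul ha.le,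
    abs_of_pos (inv_pos.2 ha), mul_inv_cancel₀ ha.ne', ENNReal.ofReal_one, one_mul]

theorem map_sMin_eq_withDensity :
    (cue 4).map (fun U : Matrix.unitaryGroup (Fin 4) ℂ => sMin U.1) =
      (volume.restrict (Set.Icc (0 : ℝ) 1)).withDensity fun s => ENNReal.ofReal (densityCUE4 s) := by
  ext B hB
  rw [map_sMin_eq_lintegral_gapKernel hB, lintegral_eq_lintegral_comp_mul_left _
    (show 0 < Real.pi / 2 by positivity), ← mul_assoc, ← ENNReal.ofReal_mul (by positivity),
    withDensity_apply _ hB, Measure.restrict_restrict hB, Set.inter_comm B,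
    ← lintegral_indicator (measurableSet_Icc.inter hB),
    ← lintegral_const_mul' _ _ ENNReal.ofReal_ne_top]
  refine lintegral_congr fun s => ?_
  have hpi := Real.pi_pos
  have hmem : Real.pi / 2 * s ∈ Set.Ioi 0 ∩ {d | d / (Real.pi / 2) ∈ B} ↔ 0 < s ∧ s ∈ B := by
    have hs : Real.pi / 2 * s / (Real.pi / 2) = s := by field_simp
    simp only [Set.mem_inter_iff, Set.mem_Ioi, Set.mem_ofPred_eq, hs,
      mul_pos_iff_of_pos_left (show 0 < Real.pi / 2 by positivity)]
  by_cases hsB : s ∈ B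
  · rcases lt_or_ge 0 s with h0 | h0
    · rw [Set.indicator_of_mem (hmem.2 ⟨h0, hsB⟩)]
      rcases le_or_gt s 1 with h1 | h1
      · rw [Set.indicator_of_mem (show s ∈ Set.Icc 0 1 ∩ B from ⟨⟨h0.le, h1⟩, hsB⟩),
          gapKernel_eq_ofReal_kernelValue (by nlinarith), kernelValue_pi_div_two_mul,
          ← ENNReal.ofReal_mul (by positivity)]
        congr 1
        field_simp
        norm_num
      · rw [Set.indicator_of_notMem fun h => absurd h.1.2 (not_le.2 h1),
          gapKernel_eq_zero (by nlinarith), mul_zero]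
    · rw [Set.indicator_of_notMem fun h => absurd (hmem.1 h).1 (not_lt.2 h0), mul_zero]
      by_cases hm : s ∈ Set.Icc 0 1 ∩ B
      · rw [Set.indicator_of_mem hm, le_antisymm h0 hm.1.1, densityCUE4_zero, ENNReal.ofReal_zero]
      · rw [Set.indicator_of_notMem hm]
  · rw [Set.indicator_of_notMem fun h => hsB (hmem.1 h).2,
      Set.indicator_of_notMem fun h => hsB h.2, mul_zero]

/-- The density of the minimal spacing, extended by zero to a continuous function on the line. -/
noncomputable def extendedDensity (s : ℝ) : ℝ :=
  densityCUE4 (max 0 (min s 1))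

theorem continuous_extendedDensity : Continuous extendedDensity :=
  continuous_densityCUE4.comp (by fun_prop)

theorem extendedDensity_nonneg (s : ℝ) : 0 ≤ extendedDensity s :=
  densityCUE4_nonneg (by simp)

theorem extendedDensity_of_mem {s : ℝ} (hs : s ∈ Set.Icc (0 : ℝ) 1) :
    extendedDensity s = densityCUE4 s := by
  rw [extendedDensity, min_eq_left hs.2, max_eq_right hs.1]

theorem extendedDensity_of_notMem {s : ℝ} (hs : s ∉ Set.Icc (0 : ℝ) 1) :
    extendedDensity s = 0 := by
  rw [extendedDensity]
  rcases lt_or_ge s 0 with h | h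
  · rw [min_eq_left (by linarith), max_eq_left h.le, densityCUE4_zero]
  · have h1 : 1 ≤ s := by
      by_contra h1
      exact hs ⟨h, (not_le.1 h1).le⟩
    rw [min_eq_right h1, max_eq_right zero_le_one, densityCUE4_one]

theorem tail_eq_integral {t : ℝ} (ht : t ≤ 2) :
    (cue 4).real {U : Matrix.unitaryGroup (Fin 4) ℂ | t < sMin U.1} =
      ∫ s in t..2, extendedDensity s := by
  have h : (cue 4) {U : Matrix.unitaryGroup (Fin 4) ℂ | t < sMin U.1} =
      ENNReal.ofReal (∫ s in t..2, extendedDensity s) := by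
    have h1 : (cue 4) {U : Matrix.unitaryGroup (Fin 4) ℂ | t < sMin U.1} =
        (cue 4).map (fun U : Matrix.unitaryGroup (Fin 4) ℂ => sMin U.1) (Set.Ioi t) :=
      (Measure.map_apply measurable_sMin measurableSet_Ioi).symm
    rw [h1, map_sMin_eq_withDensity, withDensity_apply _ measurableSet_Ioi,
      Measure.restrict_restrict measurableSet_Ioi,
      ← lintegral_Ioo_ofReal continuous_extendedDensity ht fun s _ => extendedDensity_nonneg s,
      ← lintegral_indicator (measurableSet_Ioi.inter measurableSet_Icc),
      ← lintegral_indicator measurableSet_Ioo]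
    refine lintegral_congr fun s => ?_
    by_cases hs : s ∈ Set.Icc (0 : ℝ) 1
    · by_cases hts : t < s
      · rw [Set.indicator_of_mem (show s ∈ Set.Ioi t ∩ Set.Icc 0 1 from ⟨hts, hs⟩),
          Set.indicator_of_mem (show s ∈ Set.Ioo t 2 from ⟨hts, by linarith [hs.2]⟩),
          extendedDensity_of_mem hs]
      · rw [Set.indicator_of_notMem fun h => hts h.1, Set.indicator_of_notMem fun h => hts h.1]
    · rw [Set.indicator_of_notMem fun h => hs h.2]
      by_cases hts : s ∈ Set.Ioo t 2
      · rw [Set.indicator_of_mem hts, extendedDensity_of_notMem hs, ENNReal.ofReal_zero]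
      · rw [Set.indicator_of_notMem hts]
  rw [measureReal_def, h, ENNReal.toReal_ofReal]
  exact intervalIntegral.integral_nonneg ht fun s _ => extendedDensity_nonneg s

theorem hasDerivAt_tail {t : ℝ} (ht : t ∈ Set.Icc (0 : ℝ) 1) :
    HasDerivAt (fun t : ℝ => (cue 4).real {U : Matrix.unitaryGroup (Fin 4) ℂ | t < sMin U.1})
      (-densityCUE4 t) t := by
  rw [← extendedDensity_of_mem ht]
  have h := intervalIntegral.integral_hasDerivAt_left (b := 2)
    (continuous_extendedDensity.intervalIntegrable t 2)
    continuous_extendedDensity.aestronglyMeasurable.stronglyMeasurableAtFilter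
    continuous_extendedDensity.continuousAt
  refine h.congr_of_eventuallyEq ?_
  filter_upwards [Iio_mem_nhds (show t < 2 by linarith [ht.2])] with u hu
  exact tail_eq_integral (le_of_lt hu)

end CUESpacing

theorem mainTheorem1 :
    -- `s_min` is a random variable whose law has the density `densityCUE4` on `[0, 1]`
    (AEMeasurable (fun U : Matrix.unitaryGroup (Fin 4) ℂ => CUESpacing.sMin U.1)
        (CUESpacing.cue 4) ∧
      (CUESpacing.cue 4).map (fun U : Matrix.unitaryGroup (Fin 4) ℂ => CUESpacing.sMin U.1) =
        (volume.restrict (Set.Icc (0 : ℝ) 1)).withDensity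
          (fun s => ENNReal.ofReal (CUESpacing.densityCUE4 s))) ∧
    -- `densityCUE4` is nonnegative and is minus the derivative of the tail `T(t) = P(s_min > t)`
    ∀ t ∈ Set.Icc (0 : ℝ) 1,
      0 ≤ CUESpacing.densityCUE4 t ∧
      HasDerivAt
        (fun t : ℝ => (CUESpacing.cue 4).real
          {U : Matrix.unitaryGroup (Fin 4) ℂ | t < CUESpacing.sMin U.1})
        (-CUESpacing.densityCUE4 t) t :=
  ⟨⟨CUESpacing.measurable_sMin.aemeasurable, CUESpacing.map_sMin_eq_withDensity⟩,
    fun _ ht => ⟨CUESpacing.densityCUE4_nonneg ht.2, CUESpacing.hasDerivAt_tail ht⟩⟩
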